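/- **Setting.** Let $A$ be a unital $C^*$-algebra, $\alpha:A\to A$ a $*$-homomorphism (not assumed unital or injective), and $L:A\to A$ a transfer operator for $(A,\alpha)$, i.e. a continuous linear map with $L(a)\ge 0$ for $a\ge 0$ and $L(\alpha(a)b)=aL(b)$ for all $a,b\in A$. A *Toeplitz-covariant representation* of $(A,\alpha,L)$ in a unital $C^*$-algebra $B$ is a pair $(\rho,V)$ of a unital $*$-homomorphism $\rho:A\to B$ and an element $V\in B$ with $V\rho(a)=\rho(\alpha(a))V$ and $V^*\rho(a)V=\rho(L(a))$ for all $a\in A$. Let $\mathcal T(A,\alpha,L)$ be the universal unital $C^*$-algebra for such pairs, with universal pair $(i_A,S)$. A *redundancy* is a pair $(i_A(a),k)$ with $a\in A$, $k\in\overline{\operatorname{span}}\, i_A(A)SS^*i_A(A)$ and $i_A(a)i_A(b)S=k\,i_A(b)S$ for all $b\in A$. The crossed product $A\rtimes_{\alpha,L}\mathbb N$ is the quotient of $\mathcal T(A,\alpha,L)$ by the closed two-sided ideal generated by $\{i_A(a)-k : (i_A(a),k)\text{ a redundancy},\ a\in\overline{\operatorname{span}}\,A\alpha(A)A\}$; let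 $Q$ be the quotient map. Let $M_L$ be the right Hilbert $A$-module obtained from $A$, with right action $m\cdot a=m\alpha(a)$ and inner product $\langle m,n\rangle=L(m^*n)$, by dividing out the vectors of length zero and completing; let $q:A\to M_L$ be the canonical map and $\phi:A\to\mathcal L(M_L)$ the left action, $\phi(a)q(b)=q(ab)$. Let $\Theta_{x,y}(z)=x\cdot\langle y,z\rangle$, let $\mathcal K(M_L)$ be the closed linear span of the $\Theta_{x,y}$, and put $K_\alpha:=\overline{\operatorname{span}}\,A\alpha(A)A\cap\phi^{-1}(\mathcal K(M_L))$. For a Toeplitz-covariant representation $(\rho,V)$ in $B$ let $\psi_V:M_L\to B$ be the bounded linear map with $\psi_V(q(a))=\rho(a)V$, and let $(\psi_V,\rho)^{(1)}:\mathcal K(M_L)\to B$ be the homomorphism with $\Theta_{x,y}\mapsto\psi_V(x)\psi_V(y)^*$. The pair $(\rho,V)$ is a *covariant representation* if moreover $$\text{(C3)}\qquad \rho(a)=(\psi_V,\rho)^{(1)}(\phi(a))\quad\text{for all } a\in K_\alpha.$$ **Proposition.** The pair $(j_A,T):=(Q\circ i_A,Q(S))$ is a covariant representation of $(A,\alpha,L)$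 in $A\rtimes_{\alpha,L}\mathbb N$. For every covariant representation $(\rho,V)$ of $(A,\alpha,L)$ in a $C^*$-algebra $B$ there is a representation (unital $*$-homomorphism) $\tau_{\rho,V}:A\rtimes_{\alpha,L}\mathbb N\to B$ such that $\tau_{\rho,V}\circ j_A=\rho$ and $\tau_{\rho,V}(T)=V$. -/

import Mathlib

set_option linter.unusedSectionVars false

namespace Exel

open UniformSpace

/-! ### Completing a `*`-algebra in a `C*`-seminorm -/

/-- The seminorm of a seminormed `*`-ring satisfies the `C*`-identity. -/
class PreCStarRing (F : Type*) [SeminormedRing F] [StarRing F] : Prop where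
  norm_star_mul_self : ∀ x : F, ‖star x * x‖ = ‖x‖ * ‖x‖

section Completion

variable (F : Type*) [SeminormedRing F] [StarRing F] [PreCStarRing F]

theorem PreCStarRing.norm_star_le (x : F) : ‖star x‖ ≤ ‖x‖ := by
  have key : ∀ y : F, ‖y‖ ≤ ‖star y‖ := fun y => by
    by_cases hy : ‖y‖ = 0
    · rw [hy]; exact norm_nonneg _
    · have h := PreCStarRing.norm_star_mul_self y
      have h2 := norm_mul_le (star y) y
      have h3 : 0 < ‖y‖ := lt_of_le_of_ne (norm_nonneg _) (Ne.symm hy)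
      rw [h] at h2
      exact le_of_mul_le_mul_right h2 h3
  simpa using key (star x)

instance : NormedStarGroup F := ⟨PreCStarRing.norm_star_le F⟩

noncomputable instance : Star (Completion F) := ⟨Completion.map star⟩

theorem coe_star (x : F) : ((star x : F) : Completion F) = star (x : Completion F) :=
  (Completion.map_coe star_isometry.uniformContinuous x).symm

theorem continuous_star_completion : Continuous (star : Completion F → Completion F) :=
  Completion.continuous_map

noncomputable instance : StarRing (Completion F) where
  star_involutive x := by
    induction x using Completion.induction_on with
    | hp =>
      exact isClosed_eq ((continuous_star_completion F).comp (continuous_star_completion F))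
        continuous_id
    | ih x => rw [← coe_star, ← coe_star, star_star]
  star_mul x y := by
    have hc := continuous_star_completion F
    induction x, y using Completion.induction_on₂ with
    | hp => exact isClosed_eq (by fun_prop) (by fun_prop)
    | ih x y => rw [← Completion.coe_mul, ← coe_star, ← coe_star, ← coe_star, star_mul,
        Completion.coe_mul]
  star_add x y := by
    have hc := continuous_star_completion F
    induction x, y using Completion.induction_on₂ with
    | hp => exact isClosed_eq (by fun_prop) (by fun_prop)
    | ih x y => rw [← Completion.coe_add, ← coe_star, ← coe_star, ← coe_star, star_add,
        Completion.coe_add]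

instance : CStarRing (Completion F) where
  norm_mul_self_le x := by
    have hc := continuous_star_completion F
    induction x using Completion.induction_on with
    | hp => exact isClosed_le (by fun_prop) (by fun_prop)
    | ih x => rw [← coe_star, ← Completion.coe_mul, Completion.norm_coe, Completion.norm_coe,
        PreCStarRing.norm_star_mul_self]

variable [NormedAlgebra ℂ F] [StarModule ℂ F]

noncomputable instance : NormedAlgebra ℂ (Completion F) where
  norm_smul_le := norm_smul_le

instance : StarModule ℂ (Completion F) where
  star_smul c x := by
    have hc := continuous_star_completion F
    induction x using Completion.induction_on with
    | hp =>
      exact isClosed_eq (f := fun a : Completion F => star (c • a))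
        (hc.comp (continuous_const_smul c)) (Continuous.const_smul hc (star c))
    | ih x => rw [← Completion.coe_smul, ← coe_star, ← coe_star, star_smul, Completion.coe_smul]

noncomputable instance completionCStarAlgebra : CStarAlgebra (Completion F) where

end Completion

/-! ### Quotients of `C*`-algebras by closed two-sided ideals -/

section Quotient

variable {C : Type*} [CStarAlgebra C] (I : Ideal C) [I.IsTwoSided] [hI : IsClosed (I : Set C)]

theorem exists_approx_unit {x : C} (hx : star x * x ∈ I) {ε : ℝ} (hε : 0 < ε) :
    ∃ e ∈ I, IsSelfAdjoint e ∧ ‖1 - e‖ ≤ 1 ∧ ‖x * (1 - e)‖ ≤ ε := by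
  set h : C := star x * x with hh
  have hsa : IsSelfAdjoint h := IsSelfAdjoint.star_mul_self x
  have hsp : ∀ t ∈ spectrum ℝ h, 0 ≤ t := fun t ht => spectrum_star_mul_self_nonneg t ht
  obtain ⟨N, hN⟩ : ∃ N : ℝ, 0 < N ∧ 1 / N ≤ ε ^ 2 := ⟨1 / ε ^ 2, by positivity, by simp⟩
  obtain ⟨hN0, hN1⟩ := hN
  have hne : ∀ t ∈ spectrum ℝ h, 1 + N * t ≠ 0 := fun t ht => by
    have := mul_nonneg hN0.le (hsp t ht); positivity
  set g : C := cfc (fun t : ℝ => (1 + N * t)⁻¹) h with hg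
  have hcont : ContinuousOn (fun t : ℝ => (1 + N * t)⁻¹) (spectrum ℝ h) :=
    ContinuousOn.inv₀ (by fun_prop) hne
  have hgsa : IsSelfAdjoint g := cfc_predicate _ _
  have hid : 1 - N • (h * g) = g := by
    have e1 : h * g = cfc (fun t : ℝ => t * (1 + N * t)⁻¹) h := by
      rw [cfc_mul (fun t : ℝ => t) _ h (by fun_prop) hcont, cfc_id' ℝ h]
    have hc2 : ContinuousOn (fun t : ℝ => t * (1 + N * t)⁻¹) (spectrum ℝ h) :=
      ContinuousOn.mul (by fun_prop) hcont
    rw [e1, ← cfc_const_mul N _ h hc2, ← cfc_const_one ℝ h, ← cfc_sub (fun _ : ℝ => (1 : ℝ))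
      (fun t : ℝ => N * (t * (1 + N * t)⁻¹)) h (by fun_prop) (hc2.const_smul N)]
    refine cfc_congr fun t ht => ?_
    have := hne t ht
    field_simp
    ring
  have hgn : ‖g‖ ≤ 1 := by
    refine norm_cfc_le zero_le_one fun t ht => ?_
    have h0 := mul_nonneg hN0.le (hsp t ht)
    rw [Real.norm_of_nonneg (by positivity)]
    exact inv_le_one_of_one_le₀ (by linarith)
  have hhg : ‖h * g‖ ≤ 1 / N := by
    rw [hg]
    nth_rewrite 1 [← cfc_id' ℝ h]
    rw [← cfc_mul (fun t : ℝ => t) _ h (by fun_prop) hcont]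
    refine norm_cfc_le (by positivity) fun t ht => ?_
    have h0 := mul_nonneg hN0.le (hsp t ht)
    have h1 := hsp t ht
    rw [Real.norm_of_nonneg (by positivity), ← div_eq_mul_inv, div_le_div_iff₀ (by positivity) hN0]
    linarith
  refine ⟨N • (h * g), ?_, ?_, by rw [hid]; exact hgn, ?_⟩
  · have : N • (h * g) = (algebraMap ℝ C N * h) * g := by
      rw [Algebra.smul_def]; simp only [mul_assoc]
    rw [this]
    exact I.mul_mem_right _ (I.mul_mem_left _ hx)
  · have h1 : N • (h * g) = 1 - g := by nth_rewrite 2 [← hid]; abel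
    rw [h1]
    exact (IsSelfAdjoint.one C).sub hgsa
  · rw [hid]
    have : ‖x * g‖ * ‖x * g‖ ≤ ε ^ 2 := by
      rw [← CStarRing.norm_star_mul_self, star_mul, hgsa.star_eq, mul_assoc, ← mul_assoc (star x)]
      calc ‖g * (h * g)‖ ≤ ‖g‖ * ‖h * g‖ := norm_mul_le _ _
        _ ≤ 1 * (1 / N) := by gcongr
        _ ≤ ε ^ 2 := by linarith
    nlinarith [norm_nonneg (x * g)]

theorem star_mem_of_mem {x : C} (hx : x ∈ I) : star x ∈ I := by
  have : star x ∈ closure (I : Set C) := by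
    rw [Metric.mem_closure_iff]
    intro ε hε
    obtain ⟨e, he, hs, -, h2⟩ := exists_approx_unit I (I.mul_mem_left (star x) hx) (half_pos hε)
    refine ⟨star e * star x, ?_, ?_⟩
    · rw [hs.star_eq]; exact I.mul_mem_right _ he
    · rw [dist_eq_norm, ← star_mul, ← star_sub, norm_star]
      calc ‖x - x * e‖ = ‖x * (1 - e)‖ := by rw [mul_sub, mul_one]
        _ < ε := by linarith
  rwa [hI.closure_eq] at this

theorem quotient_norm_mk_lt (x : C ⧸ I) {ε : ℝ} (hε : 0 < ε) :
    ∃ m : C, Ideal.Quotient.mk I m = x ∧ ‖m‖ < ‖x‖ + ε :=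
  Submodule.Quotient.norm_mk_lt (S := I) x hε

theorem quotient_norm_mk_le {I : Ideal C} [I.IsTwoSided] (m : C) :
    ‖(Ideal.Quotient.mk I m : C ⧸ I)‖ ≤ ‖m‖ :=
  Submodule.Quotient.norm_mk_le I m

noncomputable instance quotientNormedRing : NormedRing (C ⧸ I) :=
  { Submodule.Quotient.normedAddCommGroup I, Ideal.Quotient.ring I with
    norm_mul_le := fun x y => by
      refine ge_of_tendsto (x := nhdsWithin (0 : ℝ) (Set.Ioi 0))
        (f := fun ε => (‖x‖ + ε) * (‖y‖ + ε)) ?_ ?_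
      · have : Continuous fun ε : ℝ => (‖x‖ + ε) * (‖y‖ + ε) := by fun_prop
        simpa using (this.tendsto 0).mono_left nhdsWithin_le_nhds
      · filter_upwards [self_mem_nhdsWithin] with ε hε
        obtain ⟨a, rfl, ha⟩ := quotient_norm_mk_lt I x (Set.mem_Ioi.mp hε)
        obtain ⟨b, rfl, hb⟩ := quotient_norm_mk_lt I y (Set.mem_Ioi.mp hε)
        calc ‖Ideal.Quotient.mk I a * Ideal.Quotient.mk I b‖
            = ‖Ideal.Quotient.mk I (a * b)‖ := by rw [map_mul]
          _ ≤ ‖a * b‖ := quotient_norm_mk_le _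
          _ ≤ ‖a‖ * ‖b‖ := norm_mul_le _ _
          _ ≤ _ := mul_le_mul ha.le hb.le (norm_nonneg _) ((norm_nonneg _).trans ha.le) }

noncomputable instance quotientStar : Star (C ⧸ I) :=
  ⟨Quotient.lift (fun x => Ideal.Quotient.mk I (star x)) fun x y h => by
    have h' : -x + y ∈ I := QuotientAddGroup.leftRel_apply.mp h
    refine Ideal.Quotient.eq.mpr ?_
    have := I.neg_mem (star_mem_of_mem I h')
    simpa [sub_eq_add_neg, add_comm] using this⟩

noncomputable instance quotientStarRing : StarRing (C ⧸ I) where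
  star_involutive x := by
    obtain ⟨x, rfl⟩ := Ideal.Quotient.mk_surjective x
    exact congrArg (Ideal.Quotient.mk I) (star_star x)
  star_mul x y := by
    obtain ⟨x, rfl⟩ := Ideal.Quotient.mk_surjective x
    obtain ⟨y, rfl⟩ := Ideal.Quotient.mk_surjective y
    exact congrArg (Ideal.Quotient.mk I) (star_mul x y)
  star_add x y := by
    obtain ⟨x, rfl⟩ := Ideal.Quotient.mk_surjective x
    obtain ⟨y, rfl⟩ := Ideal.Quotient.mk_surjective y
    exact congrArg (Ideal.Quotient.mk I) (star_add x y)

theorem quotient_star_mk (x : C) :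
    star (Ideal.Quotient.mk I x) = Ideal.Quotient.mk I (star x) := rfl

noncomputable instance quotientNormedAlgebra : NormedAlgebra ℂ (C ⧸ I) :=
  { Ideal.Quotient.algebra ℂ with
    norm_smul_le := (Submodule.Quotient.normedSpace I ℂ).norm_smul_le }

instance : StarModule ℂ (C ⧸ I) where
  star_smul c x := by
    obtain ⟨x, rfl⟩ := Ideal.Quotient.mk_surjective x
    exact congrArg (Ideal.Quotient.mk I) (star_smul c x)

instance : CStarRing (C ⧸ I) where
  norm_mul_self_le x := by
    obtain ⟨x, rfl⟩ := Ideal.Quotient.mk_surjective (I := I) x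
    rw [quotient_star_mk, ← map_mul]
    refine le_of_forall_pos_le_add fun ε hε => ?_
    obtain ⟨m, hm, hlt⟩ := quotient_norm_mk_lt I (Ideal.Quotient.mk I (star x * x)) (ε := ε / 2)
      (half_pos hε)
    have hy : m - star x * x ∈ I := Ideal.Quotient.eq.mp hm
    obtain ⟨e, he, hs, h1, h2⟩ :=
      exists_approx_unit I (I.mul_mem_left (star (m - star x * x)) hy) (half_pos hε)
    have hxe : ‖Ideal.Quotient.mk I x‖ ≤ ‖x * (1 - e)‖ := by
      have : Ideal.Quotient.mk I x = Ideal.Quotient.mk I (x * (1 - e)) := by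
        refine Ideal.Quotient.eq.mpr ?_
        have : x - x * (1 - e) = x * e := by rw [mul_sub, mul_one]; abel
        rw [this]
        exact I.mul_mem_left _ he
      rw [this]
      exact quotient_norm_mk_le _
    have hs' : IsSelfAdjoint (1 - e) := (IsSelfAdjoint.one C).sub hs
    calc ‖Ideal.Quotient.mk I x‖ * ‖Ideal.Quotient.mk I x‖
        ≤ ‖x * (1 - e)‖ * ‖x * (1 - e)‖ := by gcongr
      _ = ‖(1 - e) * (star x * x * (1 - e))‖ := by
          rw [← CStarRing.norm_star_mul_self, star_mul, hs'.star_eq]; simp only [mul_assoc]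
      _ ≤ 1 * ‖star x * x * (1 - e)‖ := (norm_mul_le _ _).trans (by gcongr)
      _ = ‖m * (1 - e) - (m - star x * x) * (1 - e)‖ := by rw [one_mul, ← sub_mul, sub_sub_cancel]
      _ ≤ ‖m‖ * 1 + ε / 2 := (norm_sub_le _ _).trans
          (add_le_add ((norm_mul_le _ _).trans (by gcongr)) h2)
      _ ≤ _ := by linarith

noncomputable instance quotientCStarAlgebra : CStarAlgebra (C ⧸ I) where
  toCompleteSpace := Submodule.Quotient.completeSpace I

/-- The quotient map onto the quotient by a closed two-sided ideal. -/
noncomputable def quotientMap : C →⋆ₐ[ℂ] C ⧸ I :=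
  { Ideal.Quotient.mkₐ ℂ I with map_star' := fun _ => rfl }

/-- The closed two-sided ideal generated by a set. -/
def closedIdeal (s : Set C) : Ideal C := (TwoSidedIdeal.asIdeal (TwoSidedIdeal.span s)).closure

instance (s : Set C) : IsClosed (closedIdeal s : Set C) := isClosed_closure

instance (s : Set C) : (closedIdeal s).IsTwoSided where
  mul_mem_of_left b ha := by
    refine map_mem_closure (f := fun x => x * b) (continuous_mul_const b) ha fun x hx => ?_
    exact TwoSidedIdeal.mul_mem_right _ _ _ hx

end Quotient

/-! ### The free `*`-algebra on a set with involution -/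

section Free

/-- The free unital complex `*`-algebra on a set `X` with involution: complex linear combinations
of words in `X`, the involution reversing words and applying `star` to each letter. -/
def FreeStarAlgebra (X : Type*) := MonoidAlgebra ℂ (FreeMonoid X)

namespace FreeStarAlgebra

variable {X : Type*}

noncomputable instance : Ring (FreeStarAlgebra X) :=
  inferInstanceAs (Ring (MonoidAlgebra ℂ (FreeMonoid X)))

noncomputable instance : Algebra ℂ (FreeStarAlgebra X) :=
  inferInstanceAs (Algebra ℂ (MonoidAlgebra ℂ (FreeMonoid X)))

/-- The word `w` with coefficient `c`. -/
noncomputable def term (w : FreeMonoid X) (c : ℂ) : FreeStarAlgebra X := MonoidAlgebra.single w c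

/-- The generator given by a letter. -/
noncomputable def ι (x : X) : FreeStarAlgebra X := term (FreeMonoid.of x) 1

theorem induction_linear {motive : FreeStarAlgebra X → Prop} (x : FreeStarAlgebra X)
    (zero : motive 0) (add : ∀ x y, motive x → motive y → motive (x + y))
    (term : ∀ w c, motive (term w c)) : motive x :=
  MonoidAlgebra.induction_linear x zero add term

theorem term_mul_term (v w : FreeMonoid X) (c d : ℂ) :
    term v c * term w d = term (v * w) (c * d) :=
  MonoidAlgebra.single_mul_single v w c d

theorem smul_term (c : ℂ) (w : FreeMonoid X) (d : ℂ) : c • term w d = term w (c * d) :=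
  MonoidAlgebra.smul_single c w d

theorem one_eq : (1 : FreeStarAlgebra X) = term 1 1 := rfl

theorem term_one_mul (x : X) (w : FreeMonoid X) (c : ℂ) :
    term (FreeMonoid.of x * w) c = ι x * term w c := by
  rw [ι, term_mul_term, one_mul]

variable [InvolutiveStar X]

/-- The adjoint of a word. -/
def starWord (w : FreeMonoid X) : FreeMonoid X :=
  FreeMonoid.ofList (w.toList.map star).reverse

theorem starWord_mul (v w : FreeMonoid X) : starWord (v * w) = starWord w * starWord v := by
  simp [starWord]

theorem starWord_starWord (w : FreeMonoid X) : starWord (starWord w) = w := by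
  simp [starWord, Function.comp_def]

noncomputable instance : Star (FreeStarAlgebra X) :=
  ⟨fun f => (MonoidAlgebra.coeff f).sum fun w c => term (starWord w) (star c)⟩

theorem star_term (w : FreeMonoid X) (c : ℂ) : star (term w c) = term (starWord w) (star c) :=
  Finsupp.sum_single_index (by rw [star_zero]; exact MonoidAlgebra.single_zero _)

theorem star_add' (x y : FreeStarAlgebra X) : star (x + y) = star x + star y :=
  Finsupp.sum_add_index' (fun w => by rw [star_zero]; exact MonoidAlgebra.single_zero _)
    (fun w c d => by rw [StarAddMonoid.star_add]; exact MonoidAlgebra.single_add _ _ _)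

theorem star_zero' : star (0 : FreeStarAlgebra X) = 0 := Finsupp.sum_zero_index

noncomputable instance : StarRing (FreeStarAlgebra X) where
  star_involutive x := by
    induction x using induction_linear with
    | zero => rw [star_zero', star_zero']
    | add x y hx hy => rw [star_add', star_add', hx, hy]
    | term w c => rw [star_term, star_term, starWord_starWord, star_star]
  star_add := star_add'
  star_mul x y := by
    induction x using induction_linear with
    | zero => rw [zero_mul, star_zero', mul_zero]
    | add x x' hx hx' => rw [add_mul, star_add', star_add', hx, hx', mul_add]
    | term v c =>
      induction y using induction_linear with
      | zero => rw [mul_zero, star_zero', zero_mul]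
      | add x x' hx hx' => rw [mul_add, star_add', star_add', hx, hx', add_mul]
      | term w d => rw [term_mul_term, star_term, star_term, star_term, term_mul_term,
          starWord_mul, star_mul]

instance : StarModule ℂ (FreeStarAlgebra X) where
  star_smul c x := by
    induction x using induction_linear with
    | zero => rw [smul_zero, star_zero', smul_zero]
    | add x y hx hy => rw [smul_add, star_add', star_add', hx, hy, smul_add]
    | term w d => rw [smul_term, star_term, star_term, smul_term, star_mul, mul_comm]

theorem star_ι (x : X) : star (ι x) = ι (star x) := by
  rw [ι, star_term, star_one]; rfl

end FreeStarAlgebra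

end Free
/-! ### Transfer operators and the Toeplitz algebra -/

/-- A transfer operator for the `C*`-dynamical system `(A, α)`. -/
structure TransferOperator {A : Type*} [CStarAlgebra A] [PartialOrder A] (α : A →⋆ₙₐ[ℂ] A) where
  toCLM : A →L[ℂ] A
  nonneg : ∀ a, 0 ≤ a → 0 ≤ toCLM a
  map_mul : ∀ a b, toCLM (α a * b) = a * toCLM b

noncomputable instance {A : Type*} [CStarAlgebra A] [PartialOrder A] (α : A →⋆ₙₐ[ℂ] A) :
    CoeFun (TransferOperator α) fun _ => A → A := ⟨fun L => L.toCLM⟩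

/-- Generators for the Toeplitz algebra: a copy of `A`, one element `S` and its adjoint. -/
inductive ToeplitzGen (A : Type*)
  | of (a : A)
  | S
  | Sstar

instance {A : Type*} [InvolutiveStar A] : InvolutiveStar (ToeplitzGen A) where
  star x := match x with
    | .of a => .of (star a)
    | .S => .Sstar
    | .Sstar => .S
  star_involutive x := by cases x <;> simp

section Toeplitz

open FreeStarAlgebra ToeplitzGen

variable {A : Type*} [CStarAlgebra A] [PartialOrder A] {α : A →⋆ₙₐ[ℂ] A} (L : TransferOperator α)

/-- A `C*`-seminorm on the free `*`-algebra on `A ∪ {S}` in which the defining relations of the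
Toeplitz algebra hold: the copy of `A` is a unital homomorphic image of `A`, `S a = α(a) S` and
`S* a S = L(a)`. -/
structure IsToeplitzSeminorm (p : Seminorm ℂ (FreeStarAlgebra (ToeplitzGen A))) : Prop where
  mul_le : ∀ x y, p (x * y) ≤ p x * p y
  star_mul_self : ∀ x, p (star x * x) = p x * p x
  of_add : ∀ a b, p (ι (of (a + b)) - (ι (of a) + ι (of b))) = 0
  of_smul : ∀ (c : ℂ) a, p (ι (of (c • a)) - c • ι (of a)) = 0
  of_mul : ∀ a b, p (ι (of (a * b)) - ι (of a) * ι (of b)) = 0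
  of_one : p (ι (of 1) - 1) = 0
  S_mul : ∀ a, p (ι S * ι (of a) - ι (of (α a)) * ι S) = 0
  Sstar_mul_S : ∀ a, p (ι Sstar * ι (of a) * ι S - ι (of (L a))) = 0

theorem seminorm_eq {E : Type*} [AddCommGroup E] [Module ℂ E] (p : Seminorm ℂ E) {x y : E}
    (h : p (x - y) = 0) : p x = p y := by
  refine le_antisymm ?_ ?_
  · simpa [h] using map_add_le_add p (x - y) y
  · have := map_add_le_add p (y - x) x
    rw [map_sub_rev, h] at this
    simpa using this

variable {L} in
theorem IsToeplitzSeminorm.one_le {p : Seminorm ℂ (FreeStarAlgebra (ToeplitzGen A))}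
    (hp : IsToeplitzSeminorm L p) : p 1 ≤ 1 := by
  have h := hp.star_mul_self 1
  rw [star_one, one_mul] at h
  nlinarith [apply_nonneg p 1, sq_nonneg (p 1 - 1)]

variable {L} in
theorem IsToeplitzSeminorm.of_le {p : Seminorm ℂ (FreeStarAlgebra (ToeplitzGen A))}
    (hp : IsToeplitzSeminorm L p) (a : A) : p (ι (of a)) ≤ 2 * ‖a‖ := by
  let q : Seminorm ℂ A := Seminorm.of (fun a => p (ι (of a)))
    (fun a b => (seminorm_eq p (hp.of_add a b)).trans_le (map_add_le_add p _ _))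
    (fun c a => (seminorm_eq p (hp.of_smul c a)).trans (map_smul_eq_mul p _ _))
  have hq : ∀ u : unitary A, q u ≤ 1 := fun u => by
    have h1 : p (ι (of (u : A))) * p (ι (of (u : A))) ≤ 1 := by
      rw [← hp.star_mul_self, star_ι]
      have h2 := seminorm_eq p (hp.of_mul (star (u : A)) u)
      rw [Unitary.coe_star_mul_self, seminorm_eq p hp.of_one] at h2
      exact h2.symm.trans_le hp.one_le
    change p (ι (of (u : A))) ≤ 1
    nlinarith [apply_nonneg p (ι (of (u : A)))]
  obtain ⟨u, c, ha, hc⟩ := CStarAlgebra.exists_sum_four_unitary a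
  change q a ≤ _
  have hb : ∀ i, q (c i • (u i : A)) ≤ ‖a‖ / 2 := fun i => by
    rw [map_smul_eq_mul]
    calc ‖c i‖ * q (u i) ≤ ‖a‖ / 2 * 1 :=
          mul_le_mul (hc i) (hq _) (apply_nonneg _ _) (by positivity)
      _ = _ := mul_one _
  rw [Fin.sum_univ_four] at ha
  have h1 := map_add_le_add q (c 0 • (u 0 : A) + c 1 • (u 1 : A) + c 2 • (u 2 : A)) (c 3 • (u 3 : A))
  have h2 := map_add_le_add q (c 0 • (u 0 : A) + c 1 • (u 1 : A)) (c 2 • (u 2 : A))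
  have h3 := map_add_le_add q (c 0 • (u 0 : A)) (c 1 • (u 1 : A))
  rw [← ha] at h1
  linarith [hb 0, hb 1, hb 2, hb 3]

theorem exists_bound (x : FreeStarAlgebra (ToeplitzGen A)) :
    ∃ C : ℝ, ∀ p, IsToeplitzSeminorm L p → p x ≤ C := by
  have hS : ∃ C : ℝ, ∀ p, IsToeplitzSeminorm L p → p (ι S) ≤ C ∧ p (ι Sstar) ≤ C := by
    refine ⟨1 + 2 * ‖L 1‖, fun p hp => ?_⟩
    have key : p (ι S) * p (ι S) ≤ 2 * ‖L 1‖ := by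
      rw [← hp.star_mul_self, star_ι]
      have h1 : p (ι Sstar * ι S) ≤ p (ι Sstar * ι S - ι Sstar * ι (of 1) * ι S)
          + p (ι Sstar * ι (of 1) * ι S) := by
        have h := map_add_le_add p (ι Sstar * ι S - ι Sstar * ι (of 1) * ι S)
          (ι Sstar * ι (of 1) * ι S)
        rwa [sub_add_cancel] at h
      have h2 : p (ι Sstar * ι S - ι Sstar * ι (of 1) * ι S) ≤ 0 := by
        have e : (ι Sstar * ι S - ι Sstar * ι (of 1) * ι S : FreeStarAlgebra (ToeplitzGen A))
            = ι Sstar * (-(ι (of 1) - 1) * ι S) := by noncomm_ring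
        rw [e]
        calc _ ≤ p (ι Sstar) * (p (-(ι (of 1) - 1)) * p (ι S)) :=
              (hp.mul_le _ _).trans
                (mul_le_mul_of_nonneg_left (hp.mul_le _ _) (apply_nonneg _ _))
          _ = 0 := by rw [map_neg_eq_map, hp.of_one]; simp
      have h3 := seminorm_eq p (hp.Sstar_mul_S 1)
      change p (ι Sstar * ι S) ≤ _
      linarith [hp.of_le (L 1)]
    have h0 := norm_nonneg (L 1)
    have hle : p (ι S) ≤ 1 + 2 * ‖L 1‖ := by nlinarith [apply_nonneg p (ι S)]
    refine ⟨hle, ?_⟩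
    have h4 : p (ι Sstar) * p (ι Sstar) ≤ p (ι S) * p (ι Sstar) := by
      rw [← hp.star_mul_self, star_ι]
      exact hp.mul_le _ _
    by_cases h5 : p (ι Sstar) = 0
    · rw [h5]; positivity
    · have h6 : 0 < p (ι Sstar) := lt_of_le_of_ne (apply_nonneg _ _) (Ne.symm h5)
      exact (le_of_mul_le_mul_right h4 h6).trans hle
  induction x using FreeStarAlgebra.induction_linear with
  | zero => exact ⟨0, fun p _ => (map_zero p).le⟩
  | add x y hx hy =>
    obtain ⟨C, hC⟩ := hx
    obtain ⟨D, hD⟩ := hy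
    exact ⟨C + D, fun p hp => (map_add_le_add p _ _).trans (add_le_add (hC p hp) (hD p hp))⟩
  | term w c =>
    induction w using FreeMonoid.inductionOn' with
    | one =>
      refine ⟨‖c‖, fun p hp => ?_⟩
      have : (term 1 c : FreeStarAlgebra (ToeplitzGen A)) = c • 1 := by
        rw [one_eq, smul_term, mul_one]
      rw [this, map_smul_eq_mul]
      exact mul_le_of_le_one_right (norm_nonneg _) hp.one_le
    | of_mul x w ih =>
      obtain ⟨C, hC⟩ := ih
      obtain ⟨D, hD⟩ : ∃ D : ℝ, ∀ p, IsToeplitzSeminorm L p → p (ι x) ≤ D := by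
        obtain ⟨D, hD⟩ := hS
        cases x with
        | of a => exact ⟨_, fun p hp => hp.of_le a⟩
        | S => exact ⟨D, fun p hp => (hD p hp).1⟩
        | Sstar => exact ⟨D, fun p hp => (hD p hp).2⟩
      refine ⟨D * C, fun p hp => ?_⟩
      rw [term_one_mul]
      exact (hp.mul_le _ _).trans (mul_le_mul (hD p hp) (hC p hp) (apply_nonneg _ _)
        ((apply_nonneg _ _).trans (hD p hp)))

/-- The largest `C*`-seminorm satisfying the relations. -/
noncomputable def toeplitzNorm (x : FreeStarAlgebra (ToeplitzGen A)) : ℝ :=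
  ⨆ p : {p // IsToeplitzSeminorm L p}, p.1 x

theorem isToeplitzSeminorm_zero : IsToeplitzSeminorm L 0 := by
  constructor <;> simp

instance : Nonempty {p // IsToeplitzSeminorm L p} := ⟨⟨0, isToeplitzSeminorm_zero L⟩⟩

variable {L} in
theorem IsToeplitzSeminorm.le_toeplitzNorm {p : Seminorm ℂ (FreeStarAlgebra (ToeplitzGen A))}
    (hp : IsToeplitzSeminorm L p) (x : FreeStarAlgebra (ToeplitzGen A)) :
    p x ≤ toeplitzNorm L x := by
  obtain ⟨C, hC⟩ := exists_bound L x
  exact le_ciSup (f := fun p : {p // IsToeplitzSeminorm L p} => p.1 x)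
    ⟨C, by rintro _ ⟨q, rfl⟩; exact hC q.1 q.2⟩ ⟨p, hp⟩

variable {L} in
theorem toeplitzNorm_le {x : FreeStarAlgebra (ToeplitzGen A)} {C : ℝ}
    (h : ∀ p, IsToeplitzSeminorm L p → p x ≤ C) : toeplitzNorm L x ≤ C :=
  ciSup_le fun p => h p.1 p.2

theorem toeplitzNorm_nonneg (x : FreeStarAlgebra (ToeplitzGen A)) : 0 ≤ toeplitzNorm L x :=
  (isToeplitzSeminorm_zero L).le_toeplitzNorm x

variable {L} in
theorem toeplitzNorm_eq_zero {x : FreeStarAlgebra (ToeplitzGen A)}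
    (h : ∀ p, IsToeplitzSeminorm L p → p x = 0) : toeplitzNorm L x = 0 :=
  le_antisymm (toeplitzNorm_le fun p hp => (h p hp).le) (toeplitzNorm_nonneg L x)

theorem toeplitzNorm_star_mul_self (x : FreeStarAlgebra (ToeplitzGen A)) :
    toeplitzNorm L (star x * x) = toeplitzNorm L x * toeplitzNorm L x := by
  refine le_antisymm (toeplitzNorm_le fun p hp => ?_) ?_
  · rw [hp.star_mul_self]
    exact mul_self_le_mul_self (apply_nonneg _ _) (hp.le_toeplitzNorm x)
  · have h : toeplitzNorm L x ≤ √(toeplitzNorm L (star x * x)) := toeplitzNorm_le fun p hp =>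
      Real.le_sqrt_of_sq_le (by
        rw [sq, ← hp.star_mul_self]
        exact hp.le_toeplitzNorm _)
    exact (mul_self_le_mul_self (toeplitzNorm_nonneg L x) h).trans_eq
      (Real.mul_self_sqrt (toeplitzNorm_nonneg L _))

/-- The free `*`-algebra on `A ∪ {S}`, with the largest `C*`-seminorm satisfying the relations. -/
def ToeplitzPre (_L : TransferOperator α) := FreeStarAlgebra (ToeplitzGen A)

noncomputable instance : SeminormedRing (ToeplitzPre L) :=
  RingSeminorm.toSeminormedRing (R := FreeStarAlgebra (ToeplitzGen A))
    { toFun := toeplitzNorm L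
      map_zero' := toeplitzNorm_eq_zero fun p _ => map_zero p
      add_le' := fun x y => toeplitzNorm_le fun p hp => (map_add_le_add p x y).trans
        (add_le_add (hp.le_toeplitzNorm x) (hp.le_toeplitzNorm y))
      neg' := fun x => by simp [toeplitzNorm]
      mul_le' := fun x y => toeplitzNorm_le fun p hp => (hp.mul_le x y).trans
        (mul_le_mul (hp.le_toeplitzNorm x) (hp.le_toeplitzNorm y) (apply_nonneg _ _)
          (toeplitzNorm_nonneg L x)) }

noncomputable instance : StarRing (ToeplitzPre L) :=
  inferInstanceAs (StarRing (FreeStarAlgebra (ToeplitzGen A)))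

noncomputable instance : Algebra ℂ (ToeplitzPre L) :=
  inferInstanceAs (Algebra ℂ (FreeStarAlgebra (ToeplitzGen A)))

noncomputable instance : NormedAlgebra ℂ (ToeplitzPre L) :=
  { (inferInstance : Algebra ℂ (ToeplitzPre L)) with
    norm_smul_le := fun c x => toeplitzNorm_le fun p hp =>
      (map_smul_eq_mul p c x).trans_le
        (mul_le_mul_of_nonneg_left (hp.le_toeplitzNorm x) (norm_nonneg c)) }

instance : StarModule ℂ (ToeplitzPre L) where
  star_smul c x :=
    (inferInstance : StarModule ℂ (FreeStarAlgebra (ToeplitzGen A))).star_smul c x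

instance : PreCStarRing (ToeplitzPre L) where
  norm_star_mul_self := toeplitzNorm_star_mul_self L

/-- The Toeplitz algebra: the universal unital `C*`-algebra generated by a copy of `A` and an
element `S` subject to `S a = α(a) S` and `S* a S = L(a)`. -/
abbrev ToeplitzAlgebra := Completion (ToeplitzPre L)

/-- The class in the Toeplitz algebra of an element of the free `*`-algebra. -/
noncomputable def toToeplitz (x : FreeStarAlgebra (ToeplitzGen A)) : ToeplitzAlgebra L :=
  Completion.coe' (α := ToeplitzPre L) x

theorem toToeplitz_add (x y : FreeStarAlgebra (ToeplitzGen A)) :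
    toToeplitz L (x + y) = toToeplitz L x + toToeplitz L y :=
  Completion.coe_add (α := ToeplitzPre L) x y

theorem toToeplitz_mul (x y : FreeStarAlgebra (ToeplitzGen A)) :
    toToeplitz L (x * y) = toToeplitz L x * toToeplitz L y :=
  Completion.coe_mul (α := ToeplitzPre L) x y

theorem toToeplitz_smul (c : ℂ) (x : FreeStarAlgebra (ToeplitzGen A)) :
    toToeplitz L (c • x) = c • toToeplitz L x :=
  Completion.coe_smul (X := ToeplitzPre L) c x

theorem toToeplitz_star (x : FreeStarAlgebra (ToeplitzGen A)) :
    toToeplitz L (star x) = star (toToeplitz L x) :=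
  coe_star (ToeplitzPre L) x

theorem toToeplitz_one : toToeplitz L 1 = 1 := Completion.coe_one (ToeplitzPre L)

theorem norm_toToeplitz (x : FreeStarAlgebra (ToeplitzGen A)) :
    ‖toToeplitz L x‖ = toeplitzNorm L x :=
  Completion.norm_coe (E := ToeplitzPre L) x

theorem toToeplitz_eq {x y : FreeStarAlgebra (ToeplitzGen A)}
    (h : ∀ p, IsToeplitzSeminorm L p → p (x - y) = 0) : toToeplitz L x = toToeplitz L y := by
  have h1 : toToeplitz L (x - y) = toToeplitz L x - toToeplitz L y :=
    Completion.coe_sub (α := ToeplitzPre L) x y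
  rw [← sub_eq_zero, ← h1, ← norm_eq_zero, norm_toToeplitz]
  exact toeplitzNorm_eq_zero h

/-- The canonical homomorphism of `A` into the Toeplitz algebra. -/
noncomputable def iA : A →⋆ₐ[ℂ] ToeplitzAlgebra L :=
  { AlgHom.ofLinearMap
      { toFun := fun a => toToeplitz L (ι (of a))
        map_add' := fun a b => by
          rw [← toToeplitz_add]; exact toToeplitz_eq L fun p hp => hp.of_add a b
        map_smul' := fun c a => by
          rw [RingHom.id_apply, ← toToeplitz_smul]
          exact toToeplitz_eq L fun p hp => hp.of_smul c a }
      ((toToeplitz_eq L fun p hp => hp.of_one).trans (toToeplitz_one L))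
      (fun a b => (toToeplitz_eq L fun p hp => hp.of_mul a b).trans (toToeplitz_mul L _ _)) with
    map_star' := fun a => by
      change toToeplitz L (ι (of (star a))) = star (toToeplitz L (ι (of a)))
      rw [← toToeplitz_star, star_ι]; rfl }

/-- The canonical element `S` of the Toeplitz algebra. -/
noncomputable def toeplitzS : ToeplitzAlgebra L := toToeplitz L (ι S)

end Toeplitz

/-! ### Redundancies and the crossed product -/

section CrossedProduct

variable {A : Type*} [CStarAlgebra A] [PartialOrder A] {α : A →⋆ₙₐ[ℂ] A} (L : TransferOperator α)

/-- The closed linear span `\overline{A α(A) A}`. -/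
noncomputable def rangeIdeal (α : A →⋆ₙₐ[ℂ] A) : Submodule ℂ A :=
  (Submodule.span ℂ {x | ∃ a b c, x = a * α b * c}).topologicalClosure

/-- The pair `(i_A(a), k)` is a redundancy: `k` lies in the closed linear span of
`i_A(A) S S* i_A(A)` and `i_A(a) i_A(b) S = k i_A(b) S` for all `b`. -/
def IsRedundancy (a : A) (k : ToeplitzAlgebra L) : Prop :=
  k ∈ (Submodule.span ℂ {x : ToeplitzAlgebra L |
    ∃ b c, x = iA L b * toeplitzS L * star (toeplitzS L) * iA L c}).topologicalClosure ∧
  ∀ b, iA L a * iA L b * toeplitzS L = k * iA L b * toeplitzS L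

/-- The closed two-sided ideal generated by the differences `i_A(a) - k`, for redundancies
`(i_A(a), k)` with `a ∈ \overline{A α(A) A}`. -/
noncomputable def redundancyIdeal : Ideal (ToeplitzAlgebra L) :=
  closedIdeal {x | ∃ a ∈ rangeIdeal α, ∃ k, IsRedundancy L a k ∧ x = iA L a - k}

instance : (redundancyIdeal L).IsTwoSided := inferInstanceAs (closedIdeal _).IsTwoSided

instance : IsClosed (redundancyIdeal L : Set (ToeplitzAlgebra L)) := isClosed_closure

/-- Exel's crossed product of `A` by `α` and `L`. -/
abbrev CrossedProduct := ToeplitzAlgebra L ⧸ redundancyIdeal L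

/-- The quotient map `Q` of the Toeplitz algebra onto the crossed product. -/
noncomputable def crossedQ : ToeplitzAlgebra L →⋆ₐ[ℂ] CrossedProduct L :=
  quotientMap (redundancyIdeal L)

end CrossedProduct

/-! ### The Hilbert bimodule of a transfer operator -/

section Bimodule

variable {A : Type*} [CStarAlgebra A] [PartialOrder A] [StarOrderedRing A] {α : A →⋆ₙₐ[ℂ] A}
  (L : TransferOperator α)

theorem L_star (a : A) : L (star a) = star (L a) :=
  map_star (PositiveLinearMap.mk₀ (L.toCLM : A →ₗ[ℂ] A) L.nonneg) a

theorem L_mul_right (a b : A) : L (b * α a) = L b * a := by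
  have h := L.map_mul (star a) (star b)
  have h2 : L (α (star a) * star b) = star (L (b * α a)) := by
    rw [← L_star, star_mul, map_star]
  rw [h2, L_star] at h
  rw [← star_star (L (b * α a)), h, star_mul, star_star, star_star]

theorem L_self_nonneg (a : A) : 0 ≤ L (star a * a) := L.nonneg _ (star_mul_self_nonneg a)

theorem preInner_cauchy (x y : A) :
    ‖L (star x * y)‖ ^ 2 ≤ ‖L (star x * x)‖ * ‖L (star y * y)‖ := by
  set b := L (star x * y) with hb
  have hb' : L (star y * x) = star b := by rw [hb, ← L_star, star_mul, star_star]
  have key : ∀ t : ℝ, ‖L (star x * x)‖ ≤ t → ‖b‖ ^ 2 * t ≤ t ^ 2 * ‖L (star y * y)‖ := by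
    intro t ht
    have ht0 : 0 ≤ t := (norm_nonneg _).trans ht
    have hexp : L (star (x * α b - (t : ℂ) • y) * (x * α b - (t : ℂ) • y)) =
        star b * L (star x * x) * b - (t : ℂ) • (star b * b) - (t : ℂ) • (star b * b)
          + ((t : ℂ) * t) • L (star y * y) := by
      have e : star (x * α b - (t : ℂ) • y) * (x * α b - (t : ℂ) • y) =
          α (star b) * (star x * x * α b) - (t : ℂ) • (α (star b) * (star x * y))
            - (t : ℂ) • (star y * x * α b) + ((t : ℂ) * t) • (star y * y) := by
        rw [map_star, star_sub, star_mul, star_smul, Complex.star_def, Complex.conj_ofReal, sub_mul,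
          mul_sub, mul_sub, smul_mul_smul_comm, mul_smul_comm, smul_mul_assoc]
        simp only [mul_assoc]
        abel
      rw [e, map_add, map_sub, map_sub, map_smul, map_smul, map_smul, L.map_mul, L.map_mul,
        L_mul_right, L_mul_right, hb', ← hb, mul_assoc]
    have h0 := L_self_nonneg L (x * α b - (t : ℂ) • y)
    have h1 : star b * L (star x * x) * b ≤ (t : ℂ) • (star b * b) := by
      refine (CStarAlgebra.star_left_conjugate_le_norm_smul
        (IsSelfAdjoint.of_nonneg (L_self_nonneg L x))).trans ?_
      rw [Complex.coe_smul]
      exact smul_le_smul_of_nonneg_right ht (star_mul_self_nonneg b)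
    have h2 : (t : ℂ) • (star b * b) ≤ ((t : ℂ) * t) • L (star y * y) := by
      rw [hexp] at h0
      rw [← sub_nonneg]
      refine h0.trans ?_
      rw [← sub_nonneg] at h1 ⊢
      convert h1 using 1
      abel
    have h3 : 0 ≤ (t : ℂ) • (star b * b) := by
      rw [Complex.coe_smul]; exact smul_nonneg ht0 (star_mul_self_nonneg b)
    have h4 := CStarAlgebra.norm_le_norm_of_nonneg_of_le h3 h2
    rw [norm_smul, norm_smul, CStarRing.norm_star_mul_self, norm_mul, Complex.norm_real,
      Real.norm_of_nonneg ht0] at h4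
    nlinarith
  refine le_of_forall_pos_le_add fun ε hε => ?_
  have hn := norm_nonneg (L (star y * y))
  set n := ‖L (star y * y)‖
  have hδ : 0 < ε / (n + 1) := by positivity
  have hs := norm_nonneg (L (star x * x))
  have h := key (‖L (star x * x)‖ + ε / (n + 1)) (by linarith)
  set s := ‖L (star x * x)‖
  have h5 : ‖b‖ ^ 2 ≤ (s + ε / (n + 1)) * n := by
    refine le_of_mul_le_mul_right ?_ (by linarith : 0 < s + ε / (n + 1))
    linarith
  have h6 : ε / (n + 1) * n ≤ ε := by
    rw [div_mul_eq_mul_div, div_le_iff₀ (by linarith)]; nlinarith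
  linarith

/-- The seminorm of `A_L`. -/
noncomputable def preNorm (a : A) : ℝ := √‖L (star a * a)‖

theorem preNorm_sq (a : A) : preNorm L a ^ 2 = ‖L (star a * a)‖ := Real.sq_sqrt (norm_nonneg _)

theorem preNorm_nonneg (a : A) : 0 ≤ preNorm L a := Real.sqrt_nonneg _

theorem norm_preInner_le (x y : A) : ‖L (star x * y)‖ ≤ preNorm L x * preNorm L y := by
  have h := preInner_cauchy L x y
  rw [← preNorm_sq, ← preNorm_sq, ← mul_pow] at h
  exact (pow_le_pow_iff_left₀ (norm_nonneg _)
    (mul_nonneg (preNorm_nonneg L x) (preNorm_nonneg L y)) two_ne_zero).mp h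

theorem preNorm_add_le (x y : A) : preNorm L (x + y) ≤ preNorm L x + preNorm L y := by
  refine (pow_le_pow_iff_left₀ (preNorm_nonneg L _)
    (add_nonneg (preNorm_nonneg L x) (preNorm_nonneg L y)) two_ne_zero).mp ?_
  rw [preNorm_sq]
  have e : L (star (x + y) * (x + y)) =
      L (star x * x) + L (star x * y) + (L (star y * x) + L (star y * y)) := by
    rw [star_add, add_mul, mul_add, mul_add, map_add, map_add, map_add]
  rw [e]
  have h1 := norm_add_le (L (star x * x) + L (star x * y)) (L (star y * x) + L (star y * y))
  have h2 := norm_add_le (L (star x * x)) (L (star x * y))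
  have h3 := norm_add_le (L (star y * x)) (L (star y * y))
  nlinarith [norm_preInner_le L x y, norm_preInner_le L y x, preNorm_sq L x, preNorm_sq L y]

theorem preNorm_smul (c : ℂ) (x : A) : preNorm L (c • x) = ‖c‖ * preNorm L x := by
  rw [preNorm, preNorm, star_smul, smul_mul_smul_comm, map_smul, norm_smul, norm_mul, norm_star,
    Real.sqrt_mul (by positivity), Real.sqrt_mul_self (norm_nonneg _)]

theorem preNorm_le_of_norm_le {x y : A} {c : ℝ} (hc : 0 ≤ c)
    (h : ‖L (star x * x)‖ ≤ c ^ 2 * ‖L (star y * y)‖) : preNorm L x ≤ c * preNorm L y := by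
  refine (pow_le_pow_iff_left₀ (preNorm_nonneg L _)
    (mul_nonneg hc (preNorm_nonneg L y)) two_ne_zero).mp ?_
  rwa [mul_pow, preNorm_sq, preNorm_sq]

theorem preNorm_mul_left (a x : A) : preNorm L (a * x) ≤ ‖a‖ * preNorm L x := by
  refine preNorm_le_of_norm_le L (norm_nonneg a) ?_
  have h : star (a * x) * (a * x) ≤ ‖a‖ ^ 2 • (star x * x) := by
    rw [star_mul, mul_assoc, ← mul_assoc (star a), ← mul_assoc, sq,
      ← CStarRing.norm_star_mul_self (x := a)]
    exact CStarAlgebra.star_left_conjugate_le_norm_smul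
  have h2 : 0 ≤ L (‖a‖ ^ 2 • (star x * x) - star (a * x) * (a * x)) := L.nonneg _ (sub_nonneg.mpr h)
  rw [map_sub, sub_nonneg] at h2
  refine (CStarAlgebra.norm_le_norm_of_nonneg_of_le (L_self_nonneg L _) h2).trans ?_
  have h3 : L (‖a‖ ^ 2 • (star x * x)) = ‖a‖ ^ 2 • L (star x * x) :=
    (L.toCLM.restrictScalars ℝ).map_smul _ _
  rw [h3, norm_smul, norm_pow, norm_norm]

theorem preNorm_mul_right (a x : A) : preNorm L (x * α a) ≤ ‖a‖ * preNorm L x := by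
  refine preNorm_le_of_norm_le L (norm_nonneg a) ?_
  have : L (star (x * α a) * (x * α a)) = star a * L (star x * x) * a := by
    rw [star_mul, ← map_star, ← mul_assoc, L_mul_right, mul_assoc (α (star a)), L.map_mul]
  rw [this]
  calc _ ≤ ‖star a‖ * ‖L (star x * x)‖ * ‖a‖ := norm_mul₃_le
    _ = _ := by rw [norm_star]; ring

/-- The vector space `A_L`, a copy of `A` with the seminorm `‖a‖_L = ‖L(a* a)‖^{1/2}`. -/
def PreModule (_L : TransferOperator α) := A

noncomputable instance : SeminormedAddCommGroup (PreModule L) :=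
  AddGroupSeminorm.toSeminormedAddCommGroup (E := A)
    { toFun := preNorm L
      map_zero' := by simp [preNorm]
      add_le' := preNorm_add_le L
      neg' := fun x => by simp [preNorm] }

noncomputable instance : Module ℂ (PreModule L) := inferInstanceAs (Module ℂ A)

noncomputable instance : NormedSpace ℂ (PreModule L) where
  norm_smul_le c x := (preNorm_smul L c x).le

/-- The right Hilbert `A`-module `M_L`: the separated completion of `A_L`. -/
abbrev HilbertModule := Completion (PreModule L)

/-- The canonical map `q : A → M_L`. -/
noncomputable def q : A →ₗ[ℂ] HilbertModule L where
  toFun a := Completion.coe' (α := PreModule L) a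
  map_add' a b := Completion.coe_add (α := PreModule L) a b
  map_smul' c a := Completion.coe_smul (X := PreModule L) c a

theorem norm_q (a : A) : ‖q L a‖ = preNorm L a := Completion.norm_coe (E := PreModule L) a

variable {L} in
theorem q_induction {motive : HilbertModule L → Prop} (x : HilbertModule L)
    (closed : IsClosed {x | motive x}) (q : ∀ a, motive (q L a)) : motive x :=
  Completion.induction_on x closed q

/-- Left multiplication by `a` on `A_L`. -/
noncomputable def preLeft (a : A) : PreModule L →L[ℂ] PreModule L :=
  LinearMap.mkContinuous (E := PreModule L) (F := PreModule L)
    (show PreModule L →ₗ[ℂ] PreModule L from LinearMap.mulLeft ℂ a) ‖a‖ (preNorm_mul_left L a)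

theorem preLeft_completion_q (a b : A) : (preLeft L a).completion (q L b) = q L (a * b) :=
  ContinuousLinearMap.completion_apply_coe (preLeft L a) b

theorem clm_ext {E : Type*} [NormedAddCommGroup E] [NormedSpace ℂ E]
    {f g : HilbertModule L →L[ℂ] E} (h : ∀ a, f (q L a) = g (q L a)) : f = g := by
  ext x
  exact q_induction x (isClosed_eq f.continuous g.continuous) h

/-- The left action `φ : A → 𝓛(M_L)`, `φ(a) q(b) = q(ab)`; the adjoint of `φ(a)` is `φ(a*)`. -/
noncomputable def φ : A →ₐ[ℂ] (HilbertModule L →L[ℂ] HilbertModule L) :=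
  AlgHom.ofLinearMap
    { toFun := fun a => (preLeft L a).completion
      map_add' := fun a b => clm_ext L fun c => by
        rw [add_apply, preLeft_completion_q, preLeft_completion_q,
          preLeft_completion_q, add_mul, map_add]
      map_smul' := fun z b => clm_ext L fun c => by
        rw [RingHom.id_apply, smul_apply, preLeft_completion_q,
          preLeft_completion_q, smul_mul_assoc, map_smul] }
    (clm_ext L fun c => by
      change (preLeft L 1).completion (q L c) = q L c
      rw [preLeft_completion_q, one_mul])
    (fun a b => clm_ext L fun c => by
      change (preLeft L (a * b)).completion (q L c) =
        (preLeft L a).completion ((preLeft L b).completion (q L c))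
      rw [preLeft_completion_q, preLeft_completion_q, preLeft_completion_q, mul_assoc])

theorem φ_q (a b : A) : φ L a (q L b) = q L (a * b) := preLeft_completion_q L a b

/-- The right action of `A` on `A_L`, `m · a = m α(a)`. -/
noncomputable def preRight : PreModule L →L[ℂ] A →L[ℂ] HilbertModule L :=
  LinearMap.mkContinuous₂ (E := PreModule L)
    (LinearMap.mk₂ ℂ (M := PreModule L) (fun (m : A) (a : A) => q L (m * α a))
      (fun (m n : A) a => by rw [← map_add, ← add_mul]; rfl)
      (fun c (m : A) a => by rw [← map_smul, ← smul_mul_assoc]; rfl)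
      (fun (m : A) a b => by rw [map_add, mul_add, map_add])
      (fun c (m : A) a => by rw [map_smul, mul_smul_comm, map_smul]))
    1 (fun (m : A) a => by
      change ‖q L (m * α a)‖ ≤ 1 * preNorm L m * ‖a‖
      rw [norm_q, one_mul, mul_comm]
      exact preNorm_mul_right L a m)

/-- The right action of `A` on `M_L`, with `q(m) · a = q(m α(a))`. -/
noncomputable def rightAct : HilbertModule L →L[ℂ] A →L[ℂ] HilbertModule L :=
  (preRight L).fromCompletion

theorem rightAct_q (m a : A) : rightAct L (q L m) a = q L (m * α a) :=
  congrArg (fun f : A →L[ℂ] HilbertModule L => f a)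
    (ContinuousLinearMap.fromCompletion_apply_coe (preRight L) m)

/-- The inner product of `A_L`, `⟨m, n⟩ = L(m* n)`. -/
noncomputable def preInner : PreModule L →L⋆[ℂ] PreModule L →L[ℂ] A :=
  LinearMap.mkContinuous₂ (E := PreModule L) (F := PreModule L)
    (LinearMap.mk₂'ₛₗ (starRingEnd ℂ) (RingHom.id ℂ) (M := PreModule L) (N := PreModule L)
      (fun m n : A => L (star m * n))
      (fun (m n k : A) => by rw [← map_add, ← add_mul, ← star_add]; rfl)
      (fun c (m n : A) => by
        rw [starRingEnd_apply, ← map_smul, ← smul_mul_assoc, ← star_smul]; rfl)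
      (fun (m n k : A) => by rw [← map_add, ← mul_add]; rfl)
      (fun c (m n : A) => by rw [RingHom.id_apply, ← map_smul, ← mul_smul_comm]; rfl))
    1 (fun (m n : A) => by
      rw [one_mul]
      exact norm_preInner_le L m n)

/-- The `A`-valued inner product of `M_L`, with `⟨q(m), q(n)⟩ = L(m* n)`. -/
noncomputable def inner : HilbertModule L →L⋆[ℂ] HilbertModule L →L[ℂ] A :=
  ((preInner L).fromCompletion.flip.fromCompletion).flip

theorem inner_q (m n : A) : inner L (q L m) (q L n) = L (star m * n) := by
  have h1 : (preInner L).fromCompletion.flip.fromCompletion (q L n) =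
      (preInner L).fromCompletion.flip n :=
    ContinuousLinearMap.fromCompletion_apply_coe _ _
  have h2 : (preInner L).fromCompletion (q L m) = preInner L m :=
    ContinuousLinearMap.fromCompletion_apply_coe _ _
  rw [inner, ContinuousLinearMap.flip_apply, h1]
  exact congrArg (fun f : PreModule L →L[ℂ] A => f n) h2

/-- The rank-one operator `Θ_{x,y}(z) = x · ⟨y, z⟩`. -/
noncomputable def theta (x y : HilbertModule L) : HilbertModule L →L[ℂ] HilbertModule L :=
  (rightAct L x).comp (inner L y)

/-- The compact operators `𝓚(M_L)`: the closed linear span of the operators `Θ_{x,y}`. -/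
noncomputable def compacts : Submodule ℂ (HilbertModule L →L[ℂ] HilbertModule L) :=
  (Submodule.span ℂ {t | ∃ x y, t = theta L x y}).topologicalClosure

/-- The set `K_α = \overline{A α(A) A} ∩ J(M_L)`, where `J(M_L) = φ⁻¹(𝓚(M_L))`. -/
def Kα : Set A := {a | a ∈ rangeIdeal α ∧ φ L a ∈ compacts L}

theorem norm_sq_eq (x : HilbertModule L) : ‖x‖ ^ 2 = ‖inner L x x‖ := by
  induction x using q_induction
  case closed => exact isClosed_eq (by fun_prop) (by fun_prop)
  rename_i a
  · rw [inner_q, norm_q, preNorm_sq]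

theorem norm_inner_le (x y : HilbertModule L) : ‖inner L x y‖ ≤ ‖x‖ * ‖y‖ := by
  induction x using q_induction
  case closed => exact isClosed_le (by fun_prop) (by fun_prop)
  rename_i a
  induction y using q_induction
  case closed => exact isClosed_le (by fun_prop) (by fun_prop)
  rename_i b
  rw [inner_q, norm_q, norm_q]
  exact norm_preInner_le L a b

theorem inner_star (x y : HilbertModule L) : star (inner L x y) = inner L y x := by
  induction x using q_induction
  case closed => exact isClosed_eq (by fun_prop) (by fun_prop)
  rename_i a
  induction y using q_induction
  case closed => exact isClosed_eq (by fun_prop) (by fun_prop)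
  rename_i b
  rw [inner_q, inner_q, ← L_star, star_mul, star_star]

theorem inner_rightAct (x y : HilbertModule L) (a : A) :
    inner L x (rightAct L y a) = inner L x y * a := by
  induction x using q_induction
  case closed => exact isClosed_eq (by fun_prop) (by fun_prop)
  rename_i m
  induction y using q_induction
  case closed => exact isClosed_eq (by fun_prop) (by fun_prop)
  rename_i n
  rw [rightAct_q, inner_q, inner_q, ← mul_assoc, L_mul_right]

theorem theta_apply (x y z : HilbertModule L) : theta L x y z = rightAct L x (inner L y z) := rfl

theorem inner_theta (x y z w : HilbertModule L) :
    inner L (theta L x y z) w = inner L z (theta L y x w) := by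
  rw [← inner_star, theta_apply, theta_apply, inner_rightAct, inner_rightAct, star_mul, inner_star,
    inner_star]

/-- A pair `(ρ, V)`, with `ρ : A → B` a unital homomorphism, is a Toeplitz-covariant representation
of `(A, α, L)` in the `C*`-algebra `B`. -/
structure IsToeplitzCovariant {A : Type*} [CStarAlgebra A] [PartialOrder A] {α : A →⋆ₙₐ[ℂ] A}
    (L : TransferOperator α) {B : Type*} [CStarAlgebra B] (ρ : A →⋆ₐ[ℂ] B) (V : B) : Prop where
  tc1 : ∀ a, V * ρ a = ρ (α a) * V
  tc2 : ∀ a, star V * ρ a * V = ρ (L a)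

variable {L} {B : Type*} [CStarAlgebra B] {ρ : A →⋆ₐ[ℂ] B} {V : B}

theorem norm_mul_le_of_tc (h : IsToeplitzCovariant L ρ V) (a : A) : ‖ρ a * V‖ ≤ preNorm L a := by
  refine (pow_le_pow_iff_left₀ (norm_nonneg _) (preNorm_nonneg L _) two_ne_zero).mp ?_
  rw [preNorm_sq, sq, ← CStarRing.norm_star_mul_self, star_mul, mul_assoc, ← mul_assoc (star (ρ a)),
    ← map_star, ← map_mul, ← mul_assoc, h.tc2]
  exact NonUnitalStarAlgHom.norm_apply_le ρ _

/-- The map `a ↦ ρ(a) V` on `A_L`. -/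
noncomputable def prePsi (h : IsToeplitzCovariant L ρ V) : PreModule L →L[ℂ] B :=
  LinearMap.mkContinuous (E := PreModule L)
    (show PreModule L →ₗ[ℂ] B from (LinearMap.mulRight ℂ V).comp (ρ : A →ₐ[ℂ] B).toLinearMap) 1
    (fun (a : A) => by
      rw [one_mul]
      exact norm_mul_le_of_tc h a)

/-- The map `ψ_V : M_L → B` with `ψ_V(q(a)) = ρ(a) V`. -/
noncomputable def psi (h : IsToeplitzCovariant L ρ V) : HilbertModule L →L[ℂ] B :=
  (prePsi h).fromCompletion

theorem psi_q (h : IsToeplitzCovariant L ρ V) (a : A) : psi h (q L a) = ρ a * V :=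
  ContinuousLinearMap.fromCompletion_apply_coe (prePsi h) a

theorem psi_rightAct (h : IsToeplitzCovariant L ρ V) (x : HilbertModule L) (a : A) :
    psi h (rightAct L x a) = psi h x * ρ a := by
  induction x using q_induction
  case closed => exact isClosed_eq (by fun_prop) (by fun_prop)
  rename_i m
  rw [rightAct_q, psi_q, psi_q, map_mul, mul_assoc, mul_assoc, h.tc1]

theorem star_psi_mul_psi (h : IsToeplitzCovariant L ρ V) (x y : HilbertModule L) :
    star (psi h x) * psi h y = ρ (inner L x y) := by
  have hρ : Continuous ρ := (AddMonoidHomClass.lipschitz_of_bound ρ 1 fun x => by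
    rw [one_mul]; exact NonUnitalStarAlgHom.norm_apply_le ρ x).continuous
  induction x using q_induction
  case closed => exact isClosed_eq (by fun_prop) (by fun_prop)
  rename_i a
  induction y using q_induction
  case closed => exact isClosed_eq (by fun_prop) (by fun_prop)
  rename_i b
  rw [psi_q, psi_q, inner_q, star_mul, mul_assoc, ← mul_assoc (star (ρ a)), ← map_star, ← map_mul,
    ← mul_assoc, h.tc2]

theorem norm_psi_le (h : IsToeplitzCovariant L ρ V) (x : HilbertModule L) : ‖psi h x‖ ≤ ‖x‖ := by
  refine (pow_le_pow_iff_left₀ (norm_nonneg _) (norm_nonneg _) two_ne_zero).mp ?_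
  rw [norm_sq_eq, sq, ← CStarRing.norm_star_mul_self, star_psi_mul_psi]
  exact NonUnitalStarAlgHom.norm_apply_le ρ _

/-! ### The homomorphism `(ψ_V, ρ)^{(1)}` on the compact operators -/

variable (L) in
/-- Formal combinations of pairs `(x, y)`, mapped to the combinations of the `Θ_{x,y}`. -/
noncomputable def thetaComb : ((HilbertModule L × HilbertModule L) →₀ ℂ) →ₗ[ℂ] compacts L :=
  Finsupp.linearCombination ℂ fun p =>
    ⟨theta L p.1 p.2, Submodule.le_topologicalClosure _ (Submodule.subset_span ⟨_, _, rfl⟩)⟩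

/-- Formal combinations of pairs `(x, y)`, mapped to the combinations of the `ψ(x) ψ(y)*`. -/
noncomputable def psiComb (h : IsToeplitzCovariant L ρ V) :
    ((HilbertModule L × HilbertModule L) →₀ ℂ) →ₗ[ℂ] B :=
  Finsupp.linearCombination ℂ fun p => psi h p.1 * star (psi h p.2)

theorem le_of_pow_le {s t C : ℝ} (ht : 0 ≤ t)
    (h : ∀ k : ℕ, s ^ (2 ^ k) ≤ t ^ (2 ^ k - 1) * C) : s ≤ t := by
  by_contra! hlt
  rcases ht.eq_or_lt with rfl | ht0
  · have := h 1
    norm_num at this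
    nlinarith
  · obtain ⟨n, hn⟩ := pow_unbounded_of_one_lt (C / t) ((one_lt_div ht0).mpr hlt)
    have h1 : (s / t) ^ n ≤ (s / t) ^ (2 ^ n) :=
      pow_le_pow_right₀ ((one_lt_div ht0).mpr hlt).le n.lt_two_pow_self.le
    have h2 : (s / t) ^ (2 ^ n) ≤ C / t := by
      rw [div_pow, div_le_div_iff₀ (by positivity) ht0]
      calc s ^ 2 ^ n * t ≤ t ^ (2 ^ n - 1) * C * t := by gcongr; exact h n
        _ = C * (t ^ (2 ^ n - 1) * t) := by ring
        _ = C * t ^ 2 ^ n := by rw [pow_sub_one_mul (by positivity)]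
    linarith

/-- The formal adjoint. -/
noncomputable def adjComb (d : (HilbertModule L × HilbertModule L) →₀ ℂ) :
    (HilbertModule L × HilbertModule L) →₀ ℂ :=
  d.sum fun p c => Finsupp.single p.swap (star c)

theorem psiComb_adjComb (h : IsToeplitzCovariant L ρ V)
    (d : (HilbertModule L × HilbertModule L) →₀ ℂ) :
    psiComb h (adjComb d) = star (psiComb h d) := by
  rw [adjComb, map_finsuppSum, psiComb, Finsupp.linearCombination_apply, Finsupp.sum,
    Finsupp.sum, star_sum]
  refine Finset.sum_congr rfl fun p _ => ?_
  rw [Finsupp.linearCombination_single, star_smul, star_mul, star_star]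
  rfl

theorem thetaComb_apply (d : (HilbertModule L × HilbertModule L) →₀ ℂ) (z : HilbertModule L) :
    (thetaComb L d : HilbertModule L →L[ℂ] HilbertModule L) z =
      d.sum fun p c => c • theta L p.1 p.2 z := by
  rw [thetaComb, Finsupp.linearCombination_apply, Finsupp.sum, Finsupp.sum, Submodule.coe_sum,
    sum_apply]
  rfl

theorem inner_thetaComb (d : (HilbertModule L × HilbertModule L) →₀ ℂ) (z w : HilbertModule L) :
    inner L ((thetaComb L d : HilbertModule L →L[ℂ] HilbertModule L) z) w =
      inner L z ((thetaComb L (adjComb d) : HilbertModule L →L[ℂ] HilbertModule L) w) := by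
  have h : (thetaComb L (adjComb d) : HilbertModule L →L[ℂ] HilbertModule L) w =
      d.sum fun p c => star c • theta L p.2 p.1 w := by
    rw [adjComb, map_finsuppSum, Finsupp.sum, Finsupp.sum, Submodule.coe_sum, sum_apply]
    refine Finset.sum_congr rfl fun p _ => ?_
    rw [thetaComb, Finsupp.linearCombination_single]
    rfl
  rw [h, thetaComb_apply, Finsupp.sum, Finsupp.sum, map_sum, map_sum, sum_apply]
  refine Finset.sum_congr rfl fun p _ => ?_
  rw [map_smulₛₗ, smul_apply, inner_theta, (inner L z).map_smul]
  rfl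

theorem psiComb_mul_psi (h : IsToeplitzCovariant L ρ V)
    (d : (HilbertModule L × HilbertModule L) →₀ ℂ) (z : HilbertModule L) :
    psiComb h d * psi h z =
      psi h ((thetaComb L d : HilbertModule L →L[ℂ] HilbertModule L) z) := by
  rw [thetaComb_apply, psiComb, Finsupp.linearCombination_apply, Finsupp.sum, Finsupp.sum,
    Finset.sum_mul, map_sum]
  refine Finset.sum_congr rfl fun p _ => ?_
  rw [map_smul, theta_apply, psi_rightAct, ← star_psi_mul_psi h, smul_mul_assoc, mul_assoc]

theorem norm_adj_le {T T' : HilbertModule L →L[ℂ] HilbertModule L}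
    (hT : ∀ z w, inner L (T z) w = inner L z (T' w)) : ‖T'‖ ≤ ‖T‖ := by
  refine T'.opNorm_le_bound (norm_nonneg _) fun w => ?_
  have h1 : ‖T' w‖ ^ 2 ≤ ‖T‖ * ‖w‖ * ‖T' w‖ := by
    rw [norm_sq_eq, ← hT]
    calc _ ≤ ‖T (T' w)‖ * ‖w‖ := norm_inner_le L _ _
      _ ≤ ‖T‖ * ‖T' w‖ * ‖w‖ := by gcongr; exact T.le_opNorm _
      _ = _ := by ring
  by_cases h0 : ‖T' w‖ = 0
  · rw [h0]; positivity
  · have h2 : 0 < ‖T' w‖ := lt_of_le_of_ne (norm_nonneg _) (Ne.symm h0)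
    rw [sq] at h1
    exact le_of_mul_le_mul_right h1 h2

theorem norm_psiComb_le (h : IsToeplitzCovariant L ρ V)
    (d : (HilbertModule L × HilbertModule L) →₀ ℂ) : ‖psiComb h d‖ ≤ ‖thetaComb L d‖ := by
  set T : HilbertModule L →L[ℂ] HilbertModule L := (thetaComb L d).1 with hTdef
  set T' : HilbertModule L →L[ℂ] HilbertModule L := (thetaComb L (adjComb d)).1 with hTdef'
  set f := psiComb h d with hf
  have hnT : ‖thetaComb L d‖ = ‖T‖ := rfl
  have hT' : ‖T'‖ ≤ ‖T‖ := norm_adj_le (inner_thetaComb d)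
  set g := f * star f with hg
  have hgsa : IsSelfAdjoint g := IsSelfAdjoint.mul_star_self f
  have hgpsi : ∀ n z, g ^ n * psi h z = psi h (((T.comp T') ^ n) z) := by
    intro n
    induction n with
    | zero => intro z; simp
    | succ n ih =>
      intro z
      have e : g * psi h z = psi h (T (T' z)) := by
        rw [hg, hf, ← psiComb_adjComb, mul_assoc, psiComb_mul_psi, psiComb_mul_psi]
      rw [pow_succ, mul_assoc, e, ih, pow_succ]
      rfl
  set K : ℝ := d.sum fun p c => ‖c‖ * ‖p.1‖ * ‖p.2‖ with hK
  have hgf : ∀ n, ‖g ^ n * f‖ ≤ (‖T‖ ^ 2) ^ n * K := by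
    intro n
    have hpow : ‖(T.comp T') ^ n‖ ≤ (‖T‖ ^ 2) ^ n := by
      have h1 : ‖T.comp T'‖ ≤ ‖T‖ ^ 2 := by
        rw [sq]
        exact (T.opNorm_comp_le T').trans (by gcongr)
      induction n with
      | zero => rw [pow_zero, pow_zero]; exact ContinuousLinearMap.norm_id_le
      | succ n ih =>
        rw [pow_succ, pow_succ]
        exact (norm_mul_le _ _).trans (mul_le_mul ih h1 (norm_nonneg _) (by positivity))
    rw [hf, psiComb, Finsupp.linearCombination_apply, Finsupp.sum, Finset.mul_sum, hK, Finsupp.sum,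
      Finset.mul_sum]
    refine (norm_sum_le _ _).trans (Finset.sum_le_sum fun p _ => ?_)
    rw [mul_smul_comm, ← mul_assoc, hgpsi, norm_smul]
    have h1 : ‖psi h (((T.comp T') ^ n) p.1)‖ ≤ (‖T‖ ^ 2) ^ n * ‖p.1‖ :=
      (norm_psi_le h _).trans ((ContinuousLinearMap.le_opNorm _ _).trans (by gcongr))
    have h2 : ‖star (psi h p.2)‖ ≤ ‖p.2‖ := by rw [norm_star]; exact norm_psi_le h _
    calc _ ≤ ‖d p‖ * (((‖T‖ ^ 2) ^ n * ‖p.1‖) * ‖p.2‖) := by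
          gcongr
          exact (norm_mul_le _ _).trans (by gcongr)
      _ = _ := by ring
  have hmain : ‖f‖ ^ 2 ≤ ‖T‖ ^ 2 := by
    refine le_of_pow_le (C := K * ‖f‖) (by positivity) fun k => ?_
    have h1 : ‖g ^ 2 ^ k‖ = (‖f‖ ^ 2) ^ 2 ^ k := by
      rw [hgsa.norm_pow_two_pow, hg, CStarRing.norm_self_mul_star, sq]
    rw [← h1, ← pow_sub_one_mul (by positivity : 2 ^ k ≠ 0), hg, ← mul_assoc, ← hg]
    calc _ ≤ ‖g ^ (2 ^ k - 1) * f‖ * ‖star f‖ := norm_mul_le _ _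
      _ ≤ (‖T‖ ^ 2) ^ (2 ^ k - 1) * K * ‖f‖ := by rw [norm_star]; gcongr; exact hgf _
      _ = _ := by ring
  rw [hnT]
  exact (pow_le_pow_iff_left₀ (norm_nonneg _) (norm_nonneg _) two_ne_zero).mp hmain

instance : IsBoundedSMul ℂ (compacts L) :=
  IsBoundedSMul.of_norm_smul_le fun c x =>
    norm_smul_le c (x : HilbertModule L →L[ℂ] HilbertModule L)

/-- The map `(ψ_V, ρ)^{(1)} : 𝓚(M_L) → B`, the unique continuous linear map with
`Θ_{x,y} ↦ ψ_V(x) ψ_V(y)*`. -/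
noncomputable def psiOne (h : IsToeplitzCovariant L ρ V) : compacts L →L[ℂ] B :=
  (psiComb h).extendOfNorm (thetaComb L)

theorem denseRange_thetaComb : DenseRange (thetaComb L) := by
  intro t
  rw [closure_subtype]
  refine closure_mono ?_ t.2
  intro x hx
  have hle : Submodule.span ℂ {t | ∃ x y, t = theta L x y} ≤
      (LinearMap.range (thetaComb L)).map (compacts L).subtype := by
    rw [Submodule.span_le]
    rintro _ ⟨x, y, rfl⟩
    refine ⟨_, ⟨Finsupp.single (x, y) 1, rfl⟩, ?_⟩
    rw [thetaComb, Finsupp.linearCombination_single, one_smul]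
    rfl
  obtain ⟨y, ⟨d, hd⟩, hy⟩ := hle hx
  exact ⟨y, ⟨d, hd⟩, hy⟩

theorem theta_mem (x y : HilbertModule L) : theta L x y ∈ compacts L :=
  Submodule.le_topologicalClosure _ (Submodule.subset_span ⟨_, _, rfl⟩)

theorem psiOne_theta (h : IsToeplitzCovariant L ρ V) (x y : HilbertModule L) :
    psiOne h ⟨theta L x y, theta_mem x y⟩ = psi h x * star (psi h y) := by
  have := LinearMap.extendOfNorm_eq (f := psiComb h) (e := thetaComb L) denseRange_thetaComb
    ⟨1, fun d => by rw [one_mul]; exact norm_psiComb_le h d⟩ (Finsupp.single (x, y) 1)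
  have h1 : thetaComb L (Finsupp.single (x, y) 1) = ⟨theta L x y, theta_mem x y⟩ := by
    rw [thetaComb, Finsupp.linearCombination_single, one_smul]
  have h2 : psiComb h (Finsupp.single (x, y) 1) = psi h x * star (psi h y) := by
    rw [psiComb, Finsupp.linearCombination_single, one_smul]
  rwa [h1, h2] at this

variable (L) in
/-- A covariant representation of `(A, α, L)` in `B`: a Toeplitz-covariant representation such that
`ρ(a) = (ψ_V, ρ)^{(1)}(φ(a))` for all `a ∈ K_α`. -/
structure IsCovariant (ρ : A →⋆ₐ[ℂ] B) (V : B) : Prop extends IsToeplitzCovariant L ρ V where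
  c3 : ∀ (a : A) (ha : a ∈ Kα L), ρ a = psiOne toIsToeplitzCovariant ⟨φ L a, ha.2⟩

end Bimodule
/-! ### The universal property of the Toeplitz algebra -/

section Universal

open FreeStarAlgebra ToeplitzGen

variable {A : Type*} [CStarAlgebra A] [PartialOrder A] {α : A →⋆ₙₐ[ℂ] A} {L : TransferOperator α}

variable (L) in
theorem isToeplitzCovariant_universal : IsToeplitzCovariant L (iA L) (toeplitzS L) where
  tc1 a := by
    change toToeplitz L _ * toToeplitz L _ = toToeplitz L _ * toToeplitz L _
    rw [← toToeplitz_mul, ← toToeplitz_mul]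
    exact toToeplitz_eq L fun p hp => hp.S_mul a
  tc2 a := by
    change star (toToeplitz L _) * toToeplitz L _ * toToeplitz L _ = toToeplitz L _
    rw [← toToeplitz_star, ← toToeplitz_mul, ← toToeplitz_mul, star_ι]
    exact toToeplitz_eq L fun p hp => hp.Sstar_mul_S a

variable {B : Type*} [CStarAlgebra B] (ρ : A →⋆ₐ[ℂ] B) (V : B)

/-- The value of a generator under the pair `(ρ, V)`. -/
def evalGen : ToeplitzGen A → B
  | .of a => ρ a
  | .S => V
  | .Sstar => star V

theorem evalGen_star (x : ToeplitzGen A) : evalGen ρ V (star x) = star (evalGen ρ V x) := by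
  cases x
  · exact map_star ρ _
  · rfl
  · exact (star_star V).symm

/-- The extension of the pair `(ρ, V)` to the free `*`-algebra. -/
noncomputable def evalFree : FreeStarAlgebra (ToeplitzGen A) →ₐ[ℂ] B :=
  MonoidAlgebra.lift ℂ B (FreeMonoid (ToeplitzGen A)) (FreeMonoid.lift (evalGen ρ V))

theorem evalFree_term (w : FreeMonoid (ToeplitzGen A)) (c : ℂ) :
    evalFree ρ V (term w c) = c • FreeMonoid.lift (evalGen ρ V) w :=
  MonoidAlgebra.lift_single _ _ _

theorem evalFree_ι (x : ToeplitzGen A) : evalFree ρ V (ι x) = evalGen ρ V x := by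
  rw [ι, evalFree_term, one_smul, FreeMonoid.lift_eval_of]

theorem lift_starWord (w : FreeMonoid (ToeplitzGen A)) :
    FreeMonoid.lift (evalGen ρ V) (starWord w) = star (FreeMonoid.lift (evalGen ρ V) w) := by
  induction w using FreeMonoid.inductionOn' with
  | one => rw [map_one, star_one]; rfl
  | of_mul x w ih =>
    have h : starWord (FreeMonoid.of x) = FreeMonoid.of (star x) := rfl
    rw [starWord_mul, map_mul, map_mul, star_mul, ih, h, FreeMonoid.lift_eval_of,
      FreeMonoid.lift_eval_of, evalGen_star]

theorem evalFree_star (x : FreeStarAlgebra (ToeplitzGen A)) :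
    evalFree ρ V (star x) = star (evalFree ρ V x) := by
  induction x using FreeStarAlgebra.induction_linear with
  | zero => rw [star_zero, map_zero, star_zero]
  | add x y hx hy => rw [star_add, map_add, map_add, star_add, hx, hy]
  | term w c => rw [star_term, evalFree_term, evalFree_term, lift_starWord, star_smul]

theorem isToeplitzSeminorm_evalFree (h : IsToeplitzCovariant L ρ V) :
    IsToeplitzSeminorm L ((normSeminorm ℂ B).comp (evalFree ρ V).toLinearMap) := by
  constructor
  · intro x y
    simpa using norm_mul_le (evalFree ρ V x) (evalFree ρ V y)
  · intro x
    simpa [evalFree_star] using CStarRing.norm_star_mul_self (x := evalFree ρ V x)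
  all_goals simp [evalFree_ι, evalGen, h.tc1, h.tc2]

theorem toToeplitz_induction {motive : ToeplitzAlgebra L → Prop} (x : ToeplitzAlgebra L)
    (closed : IsClosed {x | motive x}) (coe : ∀ a, motive (toToeplitz L a)) : motive x :=
  Completion.induction_on x closed coe

/-- The continuous extension of `evalFree` to the Toeplitz algebra. -/
noncomputable def evalToeplitz (h : IsToeplitzCovariant L ρ V) : ToeplitzAlgebra L →L[ℂ] B :=
  (LinearMap.mkContinuous (E := ToeplitzPre L)
    (show ToeplitzPre L →ₗ[ℂ] B from (evalFree ρ V).toLinearMap) 1 fun x => by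
      rw [one_mul]
      exact (isToeplitzSeminorm_evalFree ρ V h).le_toeplitzNorm x).fromCompletion

theorem evalToeplitz_coe (h : IsToeplitzCovariant L ρ V) (x : FreeStarAlgebra (ToeplitzGen A)) :
    evalToeplitz ρ V h (toToeplitz L x) = evalFree ρ V x :=
  ContinuousLinearMap.fromCompletion_apply_coe (α := ToeplitzPre L) _ x

/-- The representation `ρ × V` of the Toeplitz algebra. -/
noncomputable def integratedForm (h : IsToeplitzCovariant L ρ V) : ToeplitzAlgebra L →⋆ₐ[ℂ] B :=
  { AlgHom.ofLinearMap (evalToeplitz ρ V h : ToeplitzAlgebra L →ₗ[ℂ] B)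
      (by
        change evalToeplitz ρ V h 1 = 1
        rw [← toToeplitz_one, evalToeplitz_coe, map_one])
      (fun x y => by
        change evalToeplitz ρ V h (x * y) = evalToeplitz ρ V h x * evalToeplitz ρ V h y
        induction x using toToeplitz_induction
        case closed => exact isClosed_eq (by fun_prop) (by fun_prop)
        induction y using toToeplitz_induction
        case closed => exact isClosed_eq (by fun_prop) (by fun_prop)
        rw [← toToeplitz_mul, evalToeplitz_coe, evalToeplitz_coe, evalToeplitz_coe, map_mul]) with
    map_star' := fun x => by
      change evalToeplitz ρ V h (star x) = star (evalToeplitz ρ V h x)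
      induction x using toToeplitz_induction
      case closed => exact isClosed_eq (by fun_prop) (by fun_prop)
      rw [← toToeplitz_star, evalToeplitz_coe, evalToeplitz_coe, evalFree_star] }

theorem integratedForm_coe (h : IsToeplitzCovariant L ρ V) (x : FreeStarAlgebra (ToeplitzGen A)) :
    integratedForm ρ V h (toToeplitz L x) = evalFree ρ V x := evalToeplitz_coe ρ V h x

theorem eq_evalFree {τ : ToeplitzAlgebra L →⋆ₐ[ℂ] B} (hρ : τ.comp (iA L) = ρ)
    (hV : τ (toeplitzS L) = V) (x : FreeStarAlgebra (ToeplitzGen A)) :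
    τ (toToeplitz L x) = evalFree ρ V x := by
  have hgen : ∀ x : ToeplitzGen A, τ (toToeplitz L (ι x)) = evalGen ρ V x := by
    intro x
    cases x with
    | of a => rw [← hρ]; rfl
    | S => exact hV
    | Sstar =>
      have : (ι Sstar : FreeStarAlgebra (ToeplitzGen A)) = star (ι S) := (star_ι S).symm
      rw [this, toToeplitz_star, map_star]
      exact congrArg star hV
  induction x using FreeStarAlgebra.induction_linear with
  | zero =>
    have : toToeplitz L 0 = 0 := Completion.coe_zero (α := ToeplitzPre L)
    rw [this, map_zero, map_zero]
  | add x y hx hy => rw [toToeplitz_add, map_add, map_add, hx, hy]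
  | term w c =>
    induction w using FreeMonoid.inductionOn' with
    | one =>
      have : (term 1 c : FreeStarAlgebra (ToeplitzGen A)) = c • 1 := by
        rw [one_eq, smul_term, mul_one]
      rw [this, toToeplitz_smul, toToeplitz_one, map_smul, map_smul, map_one, map_one]
    | of_mul x w ih => rw [term_one_mul, toToeplitz_mul, map_mul, map_mul, hgen, ih, evalFree_ι]

/-- Every Toeplitz-covariant representation `(ρ, V)` integrates to a unique representation `ρ × V`
of the Toeplitz algebra. -/
theorem existsUnique_integratedForm (h : IsToeplitzCovariant L ρ V) :
    ∃! τ : ToeplitzAlgebra L →⋆ₐ[ℂ] B, τ.comp (iA L) = ρ ∧ τ (toeplitzS L) = V := by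
  refine ⟨integratedForm ρ V h, ⟨?_, ?_⟩, ?_⟩
  · ext a
    exact (integratedForm_coe ρ V h (ι (of a))).trans (evalFree_ι ρ V _)
  · exact (integratedForm_coe ρ V h (ι S)).trans (evalFree_ι ρ V _)
  · rintro τ ⟨hρ, hV⟩
    have hτ : ∀ σ : ToeplitzAlgebra L →⋆ₐ[ℂ] B, Continuous σ := fun σ =>
      (AddMonoidHomClass.lipschitz_of_bound σ 1 fun x => by
        rw [one_mul]; exact NonUnitalStarAlgHom.norm_apply_le σ x).continuous
    ext x
    induction x using toToeplitz_induction
    case closed => exact isClosed_eq (hτ _) (hτ _)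
    rw [eq_evalFree ρ V hρ hV, integratedForm_coe]

end Universal

end Exel

/-!
The point is that redundancies are the same thing as compact operators coming from the left action:
`(i_A(a), k)` is a redundancy if and only if `φ(a) ∈ 𝓚(M_L)` and `k = (ψ_S, i_A)^{(1)}(φ(a))`
(`isRedundancy_iff`). Given this, the redundancy ideal is generated by the elements
`i_A(a) - (ψ_S, i_A)^{(1)}(φ(a))` with `a ∈ K_α`. As `(ψ_V, ρ)^{(1)}` is natural in `(ρ, V)`
(`psiOne_map`), the integrated form of a Toeplitz-covariant pair annihilates these generators
precisely when the pair is covariant, which gives both the covariance of `(j_A, T)` and the factorization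
of covariant representations through the quotient.

That `φ(a)` compact yields a redundancy is the identity `(ψ_V, ρ)^{(1)}(t) ψ_V(z) = ψ_V(t z)`
(`psiOne_mul_psi`). The converse needs `i_A` to be injective (`iA_injective`): then `ψ_S` and
`(ψ_S, i_A)^{(1)}` are isometric, so the closed span of `i_A(A) S S* i_A(A)` is the range of
`(ψ_S, i_A)^{(1)}` (`exists_psiOne_eq`), and an operator `t` with `k = (ψ_S, i_A)^{(1)}(t)` has to
agree with `φ(a)`.

Injectivity of `i_A` comes from a Fock representation (`isToeplitzCovariant_fock`). Instead of
tensor powers of `M_L` one can take copies of `A` as levels, the `n`-th with inner product `Lⁿ(a* b)`, and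
`a ↦ α(a)` as the creation operator from each level to the next. A positive functional on `A` makes
the inner products scalar-valued, and at level zero one finds its GNS representation; positive
functionals separate points by Hahn–Banach (`exists_positive_functional`).
-/

namespace Exel

open UniformSpace

/-! ### Representations of the compact operators -/

section Compacts

variable {A : Type*} [CStarAlgebra A] [PartialOrder A] [StarOrderedRing A] {α : A →⋆ₙₐ[ℂ] A}
  {L : TransferOperator α} {B : Type*} [CStarAlgebra B] {ρ : A →⋆ₐ[ℂ] B} {V : B}

theorem psiOne_thetaComb (h : IsToeplitzCovariant L ρ V)
    (d : (HilbertModule L × HilbertModule L) →₀ ℂ) :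
    psiOne h (thetaComb L d) = psiComb h d :=
  LinearMap.extendOfNorm_eq (f := psiComb h) (e := thetaComb L) denseRange_thetaComb
    ⟨1, fun d => by rw [one_mul]; exact norm_psiComb_le h d⟩ d

theorem compacts_induction {motive : compacts L → Prop} (t : compacts L)
    (closed : IsClosed {t | motive t}) (comb : ∀ d, motive (thetaComb L d)) : motive t :=
  denseRange_thetaComb.induction_on t closed comb

/-- The operator `(ψ_V, ρ)^{(1)}(t)` implements `t` on the image of `ψ_V`. -/
theorem psiOne_mul_psi (h : IsToeplitzCovariant L ρ V) (t : compacts L) (z : HilbertModule L) :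
    psiOne h t * psi h z =
      psi h ((t : HilbertModule L →L[ℂ] HilbertModule L) z) := by
  induction t using compacts_induction
  case closed => exact isClosed_eq (by fun_prop) (by fun_prop)
  rw [psiOne_thetaComb, psiComb_mul_psi]

theorem psi_mul_star_psi_mem (h : IsToeplitzCovariant L ρ V) (x y : HilbertModule L) :
    psi h x * star (psi h y) ∈
      (Submodule.span ℂ {z : B | ∃ b c, z = ρ b * V * star V * ρ c}).topologicalClosure := by
  induction x using q_induction
  case closed => exact (Submodule.isClosed_topologicalClosure _).preimage (by fun_prop)
  rename_i a
  induction y using q_induction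
  case closed => exact (Submodule.isClosed_topologicalClosure _).preimage (by fun_prop)
  rename_i b
  refine Submodule.le_topologicalClosure _ (Submodule.subset_span ⟨a, star b, ?_⟩)
  rw [psi_q, psi_q, star_mul, map_star, mul_assoc _ (star V)]

theorem psiOne_mem (h : IsToeplitzCovariant L ρ V) (t : compacts L) :
    psiOne h t ∈
      (Submodule.span ℂ {z : B | ∃ b c, z = ρ b * V * star V * ρ c}).topologicalClosure := by
  induction t using compacts_induction
  case closed => exact (Submodule.isClosed_topologicalClosure _).preimage (by fun_prop)
  rw [psiOne_thetaComb, psiComb, Finsupp.linearCombination_apply]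
  exact Submodule.sum_mem _ fun p _ => Submodule.smul_mem _ _ (psi_mul_star_psi_mem h _ _)

theorem continuous_starAlgHom {C D : Type*} [CStarAlgebra C] [CStarAlgebra D] (τ : C →⋆ₐ[ℂ] D) :
    Continuous τ :=
  (AddMonoidHomClass.lipschitz_of_bound τ 1 fun x => by
    rw [one_mul]; exact NonUnitalStarAlgHom.norm_apply_le τ x).continuous

theorem IsToeplitzCovariant.map (h : IsToeplitzCovariant L ρ V) {C : Type*} [CStarAlgebra C]
    (τ : B →⋆ₐ[ℂ] C) : IsToeplitzCovariant L (τ.comp ρ) (τ V) where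
  tc1 a := by
    rw [StarAlgHom.comp_apply, StarAlgHom.comp_apply, ← map_mul, ← map_mul, h.tc1]
  tc2 a := by
    rw [StarAlgHom.comp_apply, StarAlgHom.comp_apply, ← map_star, ← map_mul, ← map_mul, h.tc2]

theorem psi_map (h : IsToeplitzCovariant L ρ V) {C : Type*} [CStarAlgebra C]
    (τ : B →⋆ₐ[ℂ] C) (x : HilbertModule L) : psi (h.map τ) x = τ (psi h x) := by
  have hτ := continuous_starAlgHom τ
  induction x using q_induction
  case closed => exact isClosed_eq (by fun_prop) (by fun_prop)
  rw [psi_q, psi_q, map_mul]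
  rfl

/-- Naturality of `(ψ_V, ρ)^{(1)}` in the representation. -/
theorem psiOne_map (h : IsToeplitzCovariant L ρ V) {C : Type*} [CStarAlgebra C]
    (τ : B →⋆ₐ[ℂ] C) (t : compacts L) : psiOne (h.map τ) t = τ (psiOne h t) := by
  have hτ := continuous_starAlgHom τ
  induction t using compacts_induction
  case closed => exact isClosed_eq (by fun_prop) (by fun_prop)
  rw [psiOne_thetaComb, psiOne_thetaComb, psiComb, psiComb, Finsupp.linearCombination_apply,
    Finsupp.linearCombination_apply, map_finsuppSum]
  simp only [map_smul, map_mul, map_star, psi_map h τ]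

theorem norm_psi (h : IsToeplitzCovariant L ρ V) (hρ : Function.Injective ρ)
    (x : HilbertModule L) : ‖psi h x‖ = ‖x‖ := by
  refine (pow_left_inj₀ (norm_nonneg _) (norm_nonneg _) two_ne_zero).mp ?_
  rw [norm_sq_eq, sq, ← CStarRing.norm_star_mul_self, star_psi_mul_psi]
  exact NonUnitalStarAlgHom.norm_map ρ hρ _

theorem psi_injective (h : IsToeplitzCovariant L ρ V) (hρ : Function.Injective ρ) :
    Function.Injective (psi h) :=
  (AddMonoidHomClass.isometry_of_norm (psi h) (norm_psi h hρ)).injective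

theorem norm_le_norm_psiOne (h : IsToeplitzCovariant L ρ V) (hρ : Function.Injective ρ)
    (t : compacts L) : ‖t‖ ≤ ‖psiOne h t‖ := by
  refine ContinuousLinearMap.opNorm_le_bound _ (norm_nonneg _) fun z => ?_
  rw [← norm_psi h hρ z]
  refine (norm_psi h hρ _).symm.trans_le ?_
  exact (congrArg norm (psiOne_mul_psi h t z)).symm.trans_le (norm_mul_le _ _)

theorem isClosed_range_psiOne (h : IsToeplitzCovariant L ρ V) (hρ : Function.Injective ρ) :
    IsClosed (Set.range (psiOne h)) := by
  have : CompleteSpace (compacts L) :=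
    (Submodule.isClosed_topologicalClosure _).completeSpace_coe
  have ha : AntilipschitzWith 1 (psiOne h) :=
    AddMonoidHomClass.antilipschitz_of_bound (psiOne h) fun t => by
      rw [NNReal.coe_one, one_mul]
      exact norm_le_norm_psiOne h hρ t
  exact ha.isClosed_range (psiOne h).uniformContinuous

/-- In a faithful representation the closed span of `ρ(A) V V* ρ(A)` is exactly the range of the
isometry `(ψ_V, ρ)^{(1)}`. -/
theorem exists_psiOne_eq (h : IsToeplitzCovariant L ρ V) (hρ : Function.Injective ρ) {k : B}
    (hk : k ∈ (Submodule.span ℂ {z : B | ∃ b c, z = ρ b * V * star V * ρ c}).topologicalClosure) :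
    ∃ t, psiOne h t = k := by
  have hle : Submodule.span ℂ {z : B | ∃ b c, z = ρ b * V * star V * ρ c} ≤
      LinearMap.range (psiOne h : compacts L →ₗ[ℂ] B) := by
    rw [Submodule.span_le]
    rintro _ ⟨b, c, rfl⟩
    refine ⟨⟨theta L (q L b) (q L (star c)), theta_mem _ _⟩, ?_⟩
    change psiOne h _ = _
    rw [psiOne_theta, psi_q, psi_q, star_mul, map_star, star_star, mul_assoc _ (star V)]
  exact Submodule.topologicalClosure_minimal _ hle (isClosed_range_psiOne h hρ) hk

end Compacts

/-! ### Positive functionals -/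

section Positive

open scoped ComplexOrder

variable {A : Type*} [CStarAlgebra A] [PartialOrder A] [StarOrderedRing A]

/-- Positive functionals separate `0` from the nonzero positive elements: the closed convex cone of
positive elements is separated from `-h` by Hahn–Banach, and the separating functional is replaced
by its hermitian part. -/
theorem exists_positive_functional {h : A} (h0 : 0 ≤ h) (hne : h ≠ 0) :
    ∃ f : A →ₗ[ℂ] ℂ, (∀ a, 0 ≤ a → 0 ≤ f a) ∧ f h ≠ 0 := by
  have hconv : Convex ℝ {a : A | 0 ≤ a} := convex_Ici (𝕜 := ℝ) (0 : A)
  have hclosed : IsClosed {a : A | 0 ≤ a} := CStarAlgebra.isClosed_nonneg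
  have hnot : -h ∉ {a : A | 0 ≤ a} := fun hc => hne (le_antisymm (neg_nonneg.mp hc) h0)
  obtain ⟨f, u, hfu, hf⟩ := RCLike.geometric_hahn_banach_point_closed (𝕜 := ℂ) hconv hclosed hnot
  have hu : u < 0 := by simpa using hf 0 (le_refl (0 : A))
  have hpos : ∀ a : A, 0 ≤ a → 0 ≤ (f a).re := fun a ha => by
    by_contra! hlt
    -- At the positive multiple `(u / Re f(a)) • a` the real part of `f` would be `u`, not above it.
    have hs := hf ((u / (f a).re) • a) (smul_nonneg (div_nonneg_of_nonpos hu.le hlt.le) ha)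
    rw [← Complex.coe_smul, map_smul] at hs
    simp [hlt.ne] at hs
  -- The hermitian part, up to the factor `2`; it agrees with `2 Re f` on positive elements.
  let g : A →ₗ[ℂ] ℂ :=
    { toFun := fun a => f a + star (f (star a))
      map_add' := fun a b => by simp only [star_add, map_add]; ring
      map_smul' := fun c a => by
        simp only [star_smul, map_smul, smul_eq_mul, star_mul, star_star, RingHom.id_apply]
        ring }
  have hg : ∀ a : A, 0 ≤ a → g a = ((2 * (f a).re : ℝ) : ℂ) := fun a ha => by
    change f a + star (f (star a)) = _
    rw [(IsSelfAdjoint.of_nonneg ha).star_eq, Complex.star_def, Complex.add_conj]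
  refine ⟨g, fun a ha => ?_, ?_⟩
  · rw [hg a ha, Complex.zero_le_real]
    linarith [hpos a ha]
  · rw [hg h h0, Complex.ofReal_ne_zero]
    have : -(f h).re < u := by simpa using hfu
    linarith

end Positive

/-! ### The Fock representation -/

section Fock

open scoped ComplexOrder InnerProductSpace

variable {A : Type*} [CStarAlgebra A] [PartialOrder A] [StarOrderedRing A] {α : A →⋆ₙₐ[ℂ] A}
  (L : TransferOperator α) (f : A →ₚ[ℂ] ℂ)

theorem pow_nonneg_of_nonneg (n : ℕ) {a : A} (ha : 0 ≤ a) : 0 ≤ (L.toCLM ^ n) a := by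
  induction n with
  | zero => exact ha
  | succ n ih => rw [pow_succ']; exact L.nonneg _ ih

/-- The positive functional `f ∘ Lⁿ`. -/
noncomputable def level (n : ℕ) : A →ₚ[ℂ] ℂ :=
  PositiveLinearMap.mk₀ (f.toLinearMap ∘ₗ (L.toCLM ^ n : A →L[ℂ] A).toLinearMap) fun _ ha =>
    f.map_nonneg (pow_nonneg_of_nonneg L n ha)

theorem level_zero (a : A) : level L f 0 a = f a := rfl

theorem level_succ (n : ℕ) (a : A) : level L f (n + 1) a = level L f n (L a) := by
  change f ((L.toCLM ^ (n + 1)) a) = f ((L.toCLM ^ n) (L a))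
  rw [pow_succ]
  rfl

/-- Finitely supported sequences in `A`, carrying below the semi-inner product
`⟨x, y⟩ = ∑ₙ f(Lⁿ(xₙ* yₙ))`. Its completion plays the part of the Fock space of `M_L`, with
`Lⁿ(a* b)` as the inner product of the `n`-th level. -/
def PreFock (_L : TransferOperator α) (_f : A →ₚ[ℂ] ℂ) := ℕ →₀ A

noncomputable instance : AddCommGroup (PreFock L f) := inferInstanceAs (AddCommGroup (ℕ →₀ A))
noncomputable instance : Module ℂ (PreFock L f) := inferInstanceAs (Module ℂ (ℕ →₀ A))

variable {L f} in
/-- The sequence underlying an element of `PreFock L f`. -/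
def coord (x : PreFock L f) : ℕ →₀ A := x

/-- The semi-inner product `∑ₙ f(Lⁿ(xₙ* yₙ))`. -/
noncomputable def fockInner (x y : ℕ →₀ A) : ℂ :=
  y.sum fun n b => level L f n (star (x n) * b)

theorem fockInner_eq_sum {x y : ℕ →₀ A} {s : Finset ℕ} (hs : x.support ⊆ s ∨ y.support ⊆ s) :
    fockInner L f x y = ∑ n ∈ s, level L f n (star (x n) * y n) := by
  rw [fockInner, Finsupp.sum]
  have h1 : ∑ n ∈ y.support, level L f n (star (x n) * y n) =
      ∑ n ∈ y.support ∪ s, level L f n (star (x n) * y n) :=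
    Finset.sum_subset Finset.subset_union_left fun n _ hn => by
      rw [Finsupp.notMem_support_iff.mp hn, mul_zero, map_zero]
  rw [h1]
  refine (Finset.sum_subset Finset.subset_union_right fun n _ hn => ?_).symm
  rcases hs with hs | hs
  · rw [Finsupp.notMem_support_iff.mp fun h => hn (hs h), star_zero, zero_mul, map_zero]
  · rw [Finsupp.notMem_support_iff.mp fun h => hn (hs h), mul_zero, map_zero]

theorem star_level (n : ℕ) (a : A) : star (level L f n a) = level L f n (star a) :=
  (map_star (level L f n) a).symm

/-- The semi-inner product of `PreFock L f`. -/
noncomputable abbrev fockCore : PreInnerProductSpace.Core ℂ (PreFock L f) where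
  inner x y := fockInner L f (coord x) (coord y)
  conj_inner_symm x y := by
    change star (fockInner L f (coord y) (coord x)) = fockInner L f (coord x) (coord y)
    rw [fockInner_eq_sum L f (Or.inr subset_rfl),
      fockInner_eq_sum L f (x := coord x) (Or.inl subset_rfl), star_sum]
    refine Finset.sum_congr rfl fun n _ => ?_
    rw [star_level, star_mul, star_star]
  re_inner_nonneg x := by
    have h : 0 ≤ fockInner L f x x :=
      Finset.sum_nonneg fun n _ => (level L f n).map_nonneg (star_mul_self_nonneg _)
    exact (RCLike.nonneg_iff.mp h).1
  add_left (x y z : ℕ →₀ A) := by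
    change fockInner L f (x + y) z = fockInner L f x z + fockInner L f y z
    rw [fockInner, fockInner, fockInner, ← Finsupp.sum_add]
    refine Finsupp.sum_congr fun n _ => ?_
    rw [Finsupp.add_apply, star_add, add_mul, map_add]
  smul_left (x y : ℕ →₀ A) c := by
    change fockInner L f (c • x) y = star c * fockInner L f x y
    rw [fockInner, fockInner, Finsupp.mul_sum]
    refine Finsupp.sum_congr fun n _ => ?_
    rw [Finsupp.smul_apply, star_smul, smul_mul_assoc, map_smul, smul_eq_mul]

noncomputable instance : SeminormedAddCommGroup (PreFock L f) :=
  InnerProductSpace.Core.toSeminormedAddCommGroup (c := fockCore L f)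

noncomputable instance : InnerProductSpace ℂ (PreFock L f) :=
  InnerProductSpace.ofCore (fockCore L f)

theorem preFock_inner (x y : PreFock L f) : 
    ⟪x, y⟫_ℂ = fockInner L f (coord x) (coord y) := rfl

theorem preFock_norm_sq (x : PreFock L f) : 
    ((‖x‖ ^ 2 : ℝ) : ℂ) = fockInner L f (coord x) (coord x) := by
  rw [← preFock_inner, inner_self_eq_norm_sq_to_K]
  norm_cast

theorem norm_le_of_fockInner_le {x y : PreFock L f} {c : ℝ} (hc : 0 ≤ c)
    (h : fockInner L f (coord x) (coord x) ≤
      (c ^ 2 : ℝ) * fockInner L f (coord y) (coord y)) : ‖x‖ ≤ c * ‖y‖ := by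
  rw [← preFock_norm_sq, ← preFock_norm_sq, ← Complex.ofReal_mul, Complex.real_le_real,
    ← mul_pow] at h
  exact (pow_le_pow_iff_left₀ (norm_nonneg _) (by positivity) two_ne_zero).mp h

theorem level_star_conj_le (n : ℕ) (a b : A) (ha : IsSelfAdjoint a) :
    level L f n (star b * a * b) ≤ (‖a‖ : ℝ) * level L f n (star b * b) := by
  refine (OrderHomClass.mono (level L f n)
    (CStarAlgebra.star_left_conjugate_le_norm_smul (a := b) (b := a) ha)).trans_eq ?_
  rw [← Complex.coe_smul, map_smul, smul_eq_mul]

/-- Coordinatewise left multiplication by `a`. -/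
noncomputable def fockMul (a : A) : PreFock L f →L[ℂ] PreFock L f :=
  LinearMap.mkContinuous (E := PreFock L f) (F := PreFock L f)
    (show PreFock L f →ₗ[ℂ] PreFock L f from
      Finsupp.mapRange.linearMap (LinearMap.mulLeft ℂ a)) ‖a‖ fun (x : ℕ →₀ A) => by
    refine norm_le_of_fockInner_le L f (norm_nonneg a) ?_
    change fockInner L f (x.mapRange (a * ·) (mul_zero a)) (x.mapRange (a * ·) (mul_zero a)) ≤
      (‖a‖ ^ 2 : ℝ) * fockInner L f x x
    rw [fockInner_eq_sum L f (s := x.support) (Or.inl (Finsupp.support_mapRange)),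
      fockInner_eq_sum L f (s := x.support) (Or.inl subset_rfl), Finset.mul_sum]
    refine Finset.sum_le_sum fun n _ => ?_
    rw [Finsupp.mapRange_apply, star_mul, sq, ← CStarRing.norm_star_mul_self, mul_assoc,
      ← mul_assoc (star a), ← mul_assoc]
    exact level_star_conj_le L f n _ _ (IsSelfAdjoint.star_mul_self a)

theorem coord_fockMul (a : A) (x : PreFock L f) (n : ℕ) :
    coord (fockMul L f a x) n = a * coord x n := rfl

/-- The creation operator on sequences: `α` is applied to each entry and the result moved to the
next level, leaving `0` at level zero. -/
noncomputable def shiftLin (α : A →⋆ₙₐ[ℂ] A) : (ℕ →₀ A) →ₗ[ℂ] (ℕ →₀ A) :=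
  Finsupp.lmapDomain A ℂ Nat.succ ∘ₗ Finsupp.mapRange.linearMap (α : A →ₗ[ℂ] A)

theorem shiftLin_succ (x : ℕ →₀ A) (n : ℕ) : shiftLin α x (n + 1) = α (x n) :=
  Finsupp.mapDomain_apply Nat.succ_injective _ _

theorem fockInner_shiftLin (x y : ℕ →₀ A) :
    fockInner L f x (shiftLin α y) =
      y.sum fun n b => level L f (n + 1) (star (x (n + 1)) * α b) := by
  change (Finsupp.mapDomain Nat.succ (y.mapRange α (map_zero α))).sum _ = _
  rw [Finsupp.sum_mapDomain_index (fun n => by rw [mul_zero, map_zero])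
    (fun n b c => by rw [mul_add, map_add]), Finsupp.sum_mapRange_index
    (fun n => by rw [mul_zero, map_zero])]

/-- The creation operator on the pre-Hilbert space. It is bounded by `‖L(1)‖^{1/2}`, because
`L(α(b)* α(b)) = b* L(1) b`. -/
noncomputable def fockShift : PreFock L f →L[ℂ] PreFock L f :=
  LinearMap.mkContinuous (E := PreFock L f) (F := PreFock L f)
    (show PreFock L f →ₗ[ℂ] PreFock L f from shiftLin α) √‖L 1‖ fun (x : ℕ →₀ A) => by
    refine norm_le_of_fockInner_le L f (Real.sqrt_nonneg _) ?_
    rw [Real.sq_sqrt (norm_nonneg _)]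
    refine (fockInner_shiftLin L f _ x).trans_le ?_
    rw [fockInner, Finsupp.mul_sum]
    refine Finset.sum_le_sum fun n _ => ?_
    change level L f (n + 1) (star (shiftLin α x (n + 1)) * α (x n)) ≤ _
    have e : L (star (α (x n)) * α (x n)) = star (x n) * L 1 * x n := by
      rw [L_mul_right, ← map_star, ← mul_one (α _), L.map_mul]
    rw [shiftLin_succ, level_succ, e]
    exact level_star_conj_le L f n _ _ (IsSelfAdjoint.of_nonneg (L.nonneg _ zero_le_one))

theorem coord_fockShift (x : PreFock L f) : coord (fockShift L f x) = shiftLin α (coord x) := rfl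

/-- The Hilbert space on which the Fock representation acts. -/
abbrev Fock := Completion (PreFock L f)

theorem fock_ext {S T : Fock L f →L[ℂ] Fock L f}
    (h : ∀ x : PreFock L f, S (x : Fock L f) = T (x : Fock L f)) : S = T := by
  ext x
  induction x using Completion.induction_on with
  | hp => exact isClosed_eq S.continuous T.continuous
  | ih x => exact h x

/-- The representation of `A` on the Fock space by coordinatewise left multiplication. -/
noncomputable def fockRep : A →⋆ₐ[ℂ] (Fock L f →L[ℂ] Fock L f) :=
  { AlgHom.ofLinearMap
      { toFun := fun a => (fockMul L f a).completion
        map_add' := fun a b => fock_ext L f fun x => by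
          rw [add_apply, ContinuousLinearMap.completion_apply_coe,
            ContinuousLinearMap.completion_apply_coe, ContinuousLinearMap.completion_apply_coe,
            ← Completion.coe_add]
          exact congrArg _ (Finsupp.ext fun n => add_mul a b _)
        map_smul' := fun c a => fock_ext L f fun x => by
          rw [RingHom.id_apply, smul_apply, ContinuousLinearMap.completion_apply_coe,
            ContinuousLinearMap.completion_apply_coe, ← Completion.coe_smul]
          exact congrArg _ (Finsupp.ext fun n => smul_mul_assoc c a _) }
      (fock_ext L f fun x => by
        refine (ContinuousLinearMap.completion_apply_coe _ _).trans ?_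
        exact congrArg _ (Finsupp.ext fun n => one_mul _))
      (fun a b => fock_ext L f fun x => by
        change (fockMul L f (a * b)).completion x =
          (fockMul L f a).completion ((fockMul L f b).completion x)
        rw [ContinuousLinearMap.completion_apply_coe, ContinuousLinearMap.completion_apply_coe,
          ContinuousLinearMap.completion_apply_coe]
        exact congrArg _ (Finsupp.ext fun n => mul_assoc a b _)) with
    map_star' := fun a => by
      refine (ContinuousLinearMap.eq_adjoint_iff (fockMul L f (star a)).completion
        (fockMul L f a).completion).mpr fun x y => ?_
      induction x, y using Completion.induction_on₂ with
      | hp => exact isClosed_eq (by fun_prop) (by fun_prop)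
      | ih x y =>
        rw [ContinuousLinearMap.completion_apply_coe, ContinuousLinearMap.completion_apply_coe,
          Completion.inner_coe, Completion.inner_coe, preFock_inner, preFock_inner,
          fockInner_eq_sum L f (s := (coord x).support ∪ (coord y).support) 
            (Or.inr Finset.subset_union_right),
          fockInner_eq_sum L f (s := (coord x).support ∪ (coord y).support) 
            (Or.inl Finset.subset_union_left)]
        refine Finset.sum_congr rfl fun n _ => ?_
        rw [coord_fockMul, coord_fockMul, star_mul, star_star, mul_assoc] }

theorem fockRep_coe (a : A) (x : PreFock L f) :
    fockRep L f a (x : Fock L f) = (fockMul L f a x : PreFock L f) :=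
  ContinuousLinearMap.completion_apply_coe _ _

/-- The creation operator on the Fock space. -/
noncomputable def fockV : Fock L f →L[ℂ] Fock L f := (fockShift L f).completion

theorem fockV_coe (x : PreFock L f) :
    fockV L f (x : Fock L f) = (fockShift L f x : PreFock L f) :=
  ContinuousLinearMap.completion_apply_coe _ _

/-- The relation `V* a V = L(a)` holds because the inner product of level `n + 1` is that of level
`n` composed with `L`, and `L((a α(b))* α(c)) = (L(a) b)* c`; no formula for the adjoint of `V` is
needed. -/
theorem isToeplitzCovariant_fock : IsToeplitzCovariant L (fockRep L f) (fockV L f) where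
  tc1 a := fock_ext L f fun x => by
    change fockV L f (fockRep L f a _) = fockRep L f (α a) (fockV L f _)
    rw [fockRep_coe, fockV_coe, fockV_coe, fockRep_coe]
    have e : fockShift L f (fockMul L f a x) = fockMul L f (α a) (fockShift L f x) := by
      refine Finsupp.ext fun n => ?_
      change coord (fockShift L f (fockMul L f a x)) n =
        coord (fockMul L f (α a) (fockShift L f x)) n
      rw [coord_fockMul, coord_fockShift, coord_fockShift]
      cases n with
      | zero =>
        have h0 : ∀ y : ℕ →₀ A, shiftLin α y 0 = 0 := fun y =>
          Finsupp.mapDomain_of_notMem_range _ _ (by simp)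
        rw [h0, h0, mul_zero]
      | succ n => rw [shiftLin_succ, shiftLin_succ, coord_fockMul, map_mul]
    rw [e]
  tc2 a := by
    rw [ContinuousLinearMap.star_eq_adjoint, mul_assoc]
    refine fock_ext L f fun x => ext_inner_right ℂ fun y => ?_
    change ⟪ContinuousLinearMap.adjoint (fockV L f) (fockRep L f a (fockV L f x)), y⟫_ℂ = _
    rw [ContinuousLinearMap.adjoint_inner_left]
    induction y using Completion.induction_on with
    | hp => exact isClosed_eq (by fun_prop) (by fun_prop)
    | ih y =>
      rw [fockV_coe, fockV_coe, fockRep_coe, fockRep_coe, Completion.inner_coe,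
        Completion.inner_coe, preFock_inner, preFock_inner]
      refine (fockInner_shiftLin L f _ _).trans (Finsupp.sum_congr fun n _ => ?_)
      rw [coord_fockMul, coord_fockMul, coord_fockShift, shiftLin_succ, level_succ,
        L_mul_right, star_mul, ← map_star α, L.map_mul, L_star, star_mul, mul_assoc]

/-- At level zero the Fock representation is the GNS representation of `f`. -/
theorem fockRep_ne_zero {a : A} (ha : f (star a * a) ≠ 0) : fockRep L f a ≠ 0 := by
  intro h0
  let x : PreFock L f := (Finsupp.single 0 1 : ℕ →₀ A)
  have h1 : fockRep L f a (x : Fock L f) = 0 := by rw [h0]; rfl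
  rw [fockRep_coe, ← norm_eq_zero, Completion.norm_coe] at h1
  have hs : (coord (fockMul L f a x)).support ⊆ (coord x).support :=
    Finsupp.support_mapRange (hf := mul_zero a)
  have h2 := preFock_norm_sq L f (fockMul L f a x)
  rw [h1, fockInner_eq_sum L f (s := {0}) (Or.inl (hs.trans
    Finsupp.support_single_subset)), Finset.sum_singleton, coord_fockMul, level_zero] at h2
  have hx : coord x 0 = 1 := Finsupp.single_eq_same
  rw [hx, mul_one] at h2
  simp [ha.symm] at h2

end Fock

open scoped ComplexOrder in
/-- The Toeplitz algebra contains a faithful copy of `A`: for `a ≠ 0` the Fock representation over a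
positive functional `f` with `f(a* a) ≠ 0` does not annihilate `a`, and it factors through `iA`. -/
theorem iA_injective {A : Type*} [CStarAlgebra A] [PartialOrder A] [StarOrderedRing A]
    {α : A →⋆ₙₐ[ℂ] A} (L : TransferOperator α) : Function.Injective (iA L) := by
  rw [injective_iff_map_eq_zero]
  intro a ha
  by_contra hne
  obtain ⟨f, hf, hfa⟩ := exists_positive_functional (star_mul_self_nonneg a)
    ((CStarRing.star_mul_self_eq_zero_iff a).not.mpr hne)
  let g : A →ₚ[ℂ] ℂ := PositiveLinearMap.mk₀ f hf
  obtain ⟨τ, ⟨hτ, -⟩, -⟩ := existsUnique_integratedForm _ _ (isToeplitzCovariant_fock L g)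
  refine fockRep_ne_zero L g (a := a) hfa ?_
  rw [← hτ, StarAlgHom.comp_apply, ha, map_zero]

/-! ### Redundancies and the crossed product -/

section Redundancy

variable {A : Type*} [CStarAlgebra A] [PartialOrder A] [StarOrderedRing A] {α : A →⋆ₙₐ[ℂ] A}
  (L : TransferOperator α)

/-- Since `A` embeds in the Toeplitz algebra, the second member of a redundancy is determined by
the first, and a redundancy over `a` exists only if `φ(a)` is compact. -/
theorem isRedundancy_iff (a : A) (k : ToeplitzAlgebra L) :
    IsRedundancy L a k ↔ ∃ ha : φ L a ∈ compacts L,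
      k = psiOne (isToeplitzCovariant_universal L) ⟨φ L a, ha⟩ := by
  set h := isToeplitzCovariant_universal L
  constructor
  · rintro ⟨hk, hmul⟩
    obtain ⟨t, rfl⟩ := exists_psiOne_eq h (iA_injective L) hk
    have ht : (t : HilbertModule L →L[ℂ] HilbertModule L) = φ L a := clm_ext L fun b => by
      refine psi_injective h (iA_injective L) ?_
      rw [← psiOne_mul_psi, φ_q, psi_q, psi_q, ← mul_assoc, ← hmul, map_mul]
    refine ⟨ht ▸ t.2, ?_⟩
    congr 1
    exact Subtype.ext ht
  · rintro ⟨ha, rfl⟩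
    refine ⟨psiOne_mem h _, fun b => ?_⟩
    rw [mul_assoc (psiOne h _), ← psi_q h, psiOne_mul_psi, φ_q, psi_q, map_mul]

/-- The quotient map imposes the covariance condition: over `a ∈ K_α` there is the redundancy
with second member `(ψ_S, i_A)^{(1)}(φ(a))`. -/
theorem crossedQ_iA {a : A} (ha : a ∈ Kα L) :
    crossedQ L (iA L a) =
      crossedQ L (psiOne (isToeplitzCovariant_universal L) ⟨φ L a, ha.2⟩) := by
  refine Ideal.Quotient.eq.mpr (subset_closure ?_)
  exact TwoSidedIdeal.subset_span
    ⟨a, ha.1, _, (isRedundancy_iff L a _).mpr ⟨ha.2, rfl⟩, rfl⟩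

theorem isCovariant_crossedProduct :
    IsCovariant L ((crossedQ L).comp (iA L)) (crossedQ L (toeplitzS L)) where
  toIsToeplitzCovariant := (isToeplitzCovariant_universal L).map (crossedQ L)
  c3 a ha := by
    rw [psiOne_map (isToeplitzCovariant_universal L)]
    exact crossedQ_iA L ha

variable {B : Type*} [CStarAlgebra B]

/-- A closed two-sided ideal is contained in the kernel of a `*`-homomorphism as soon as its
generators are. -/
theorem map_eq_zero_of_mem_closedIdeal {C : Type*} [CStarAlgebra C] (τ : C →⋆ₐ[ℂ] B) {s : Set C}
    (hs : ∀ x ∈ s, τ x = 0) {x : C} (hx : x ∈ closedIdeal s) : τ x = 0 := by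
  refine closure_minimal (fun y hy => ?_)
    (isClosed_singleton.preimage (continuous_starAlgHom τ)) hx
  have hle : TwoSidedIdeal.span s ≤ TwoSidedIdeal.ker τ :=
    TwoSidedIdeal.span_le.mpr fun z hz => (TwoSidedIdeal.mem_ker τ).mpr (hs z hz)
  exact (TwoSidedIdeal.mem_ker τ).mp (hle hy)

variable {L} {ρ : A →⋆ₐ[ℂ] B} {V : B}

/-- The integrated form of a covariant representation annihilates the redundancy ideal. -/
theorem IsCovariant.eq_zero_of_mem_redundancyIdeal (h : IsCovariant L ρ V)
    {τ : ToeplitzAlgebra L →⋆ₐ[ℂ] B} (hρ : τ.comp (iA L) = ρ) (hV : τ (toeplitzS L) = V)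
    {x : ToeplitzAlgebra L} (hx : x ∈ redundancyIdeal L) : τ x = 0 := by
  subst hρ hV
  refine map_eq_zero_of_mem_closedIdeal τ ?_ hx
  rintro _ ⟨a, ha, k, hk, rfl⟩
  obtain ⟨hφ, rfl⟩ := (isRedundancy_iff L a k).mp hk
  rw [map_sub, sub_eq_zero, ← psiOne_map]
  exact h.c3 a ⟨ha, hφ⟩

/-- The representation of the crossed product induced by a representation of the Toeplitz algebra
that annihilates the redundancy ideal. -/
noncomputable def crossedLift {τ : ToeplitzAlgebra L →⋆ₐ[ℂ] B}
    (hτ : ∀ x ∈ redundancyIdeal L, τ x = 0) : CrossedProduct L →⋆ₐ[ℂ] B :=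
  { Ideal.Quotient.liftₐ (redundancyIdeal L) (τ : ToeplitzAlgebra L →ₐ[ℂ] B) hτ with
    map_star' := fun x => by
      obtain ⟨x, rfl⟩ := Ideal.Quotient.mk_surjective x
      exact map_star τ x }

theorem crossedLift_crossedQ {τ : ToeplitzAlgebra L →⋆ₐ[ℂ] B}
    (hτ : ∀ x ∈ redundancyIdeal L, τ x = 0) (x : ToeplitzAlgebra L) :
    crossedLift hτ (crossedQ L x) = τ x := rfl

end Redundancy

end Exel

theorem mainTheorem4 {A : Type*} [CStarAlgebra A] [PartialOrder A] [StarOrderedRing A]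
    (α : A →⋆ₙₐ[ℂ] A) (L : Exel.TransferOperator α) :
    Exel.IsCovariant L ((Exel.crossedQ L).comp (Exel.iA L)) (Exel.crossedQ L (Exel.toeplitzS L)) ∧
    ∀ (B : Type*) [CStarAlgebra B] (ρ : A →⋆ₐ[ℂ] B) (V : B), Exel.IsCovariant L ρ V →
      ∃ τ : Exel.CrossedProduct L →⋆ₐ[ℂ] B,
        τ.comp ((Exel.crossedQ L).comp (Exel.iA L)) = ρ ∧
        τ (Exel.crossedQ L (Exel.toeplitzS L)) = V := by
  refine ⟨Exel.isCovariant_crossedProduct L, fun B _ ρ V h => ?_⟩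
  obtain ⟨τ, ⟨hρ, hV⟩, -⟩ := Exel.existsUnique_integratedForm ρ V h.toIsToeplitzCovariant
  refine ⟨Exel.crossedLift fun x hx => h.eq_zero_of_mem_redundancyIdeal hρ hV hx, ?_, ?_⟩
  · exact hρ
  · rw [Exel.crossedLift_crossedQ, hV]
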